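/- Let $d\ge 1$, $n\ge 1$, let $\mathcal X$ be a subset of a real normed space, and let $f:\mathbb R^d\times\mathcal X\to\mathbb R$. Assume: (i) for every $x\in\mathcal X$ the function $f(\cdot,x)$ is differentiable, and there are $K_1,K_2>0$ with $\|\nabla f(\theta,x)-\nabla f(\hat\theta,\hat x)\|\le K_1\|\theta-\hat\theta\|+K_2\|x-\hat x\|(\|\theta\|+\|\hat\theta\|+1)$ for all $\theta,\hat\theta\in\mathbb R^d$ and $x,\hat x\in\mathcal X$; (ii) there are $B,m,K>0$ with $\|\nabla f(0,x)\|\le B$ and $\langle\nabla f(\theta_1,x)-\nabla f(\theta_2,x),\theta_1-\theta_2\rangle\ge m\|\theta_1-\theta_2\|^2-K$ for all $\theta_1,\theta_2\in\mathbb R^d$ and $x\in\mathcal X$; (iii) (bounded data) $\|x-\hat x\|\le D<\infty$ for all $x,\hat x\in\mathcal X$; (iv) (universal stable point) $\vartheta_\star\in\mathbb R^d$ satisfies $\nabla f(\vartheta_\star,x)=0$ for every $x\in\mathcal X$. Let $\alpha\in(1,2)$, $0<p<\min(\tfrac12,\alpha-1)$, $\eta>0$, $\sigma>0$, and let $\xi$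 be a random vector in $\mathbb R^d$ with the rotationally invariant $\alpha$-stable law $\mathbb E\,e^{\mathrm i u^\top\xi}=e^{-\|u\|^\alpha}$, $u\in\mathbb R^d$. Let $X=(x_1,\dots,x_n)$ and $\hat X=(\hat x_1,\dots,\hat x_n)$ in $\mathcal X^n$ differ in at most one entry, and put $F(\theta,X)=\frac1n\sum_{i=1}^n f(\theta,x_i)$. Let $P$ and $\hat P$ be the transition kernels of the noisy gradient descent chains $\theta_k=\theta_{k-1}-\eta\nabla F(\theta_{k-1},X)+\sigma\xi_k$ and $\hat\theta_k=\hat\theta_{k-1}-\eta\nabla F(\hat\theta_{k-1},\hat X)+\sigma\xi_k$ with $\xi_k$ i.i.d. copies of $\xi$; that is, $P(\theta,\cdot)$ is the law of $\theta-\eta\nabla F(\theta,X)+\sigma\xi$, and similarly for $\hat P$. Set $$V_p(\theta)=(1+\|\theta-\vartheta_\star\|^2)^{p/2},\qquad \hat V_p(\theta)=V_{1+p}(\theta)=(1+\|\theta-\vartheta_\star\|^2)^{(1+p)/2},$$ and $\|\mu-\nu\|_V=\sup_{|g|\le V}\left|\int g\,d\mu-\int g\,d\nu\right|$, the supremum being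 over measurable $g$. Then for every $\theta$ the function $V_p$ is integrable with respect to $P(\theta,\cdot)$ and $\hat P(\theta,\cdot)$, and $$\sup_{\theta\in\mathbb R^d}\frac{\|P(\theta,\cdot)-\hat P(\theta,\cdot)\|_{V_p}}{\hat V_p(\theta)}\le\frac{C_\gamma}{n},\qquad C_\gamma=(C_6+C_7)(2+\|\vartheta_\star\|),$$ where $C_\gamma$ does not depend on $n$ (and is positive when $D>0$), with $$C_6=\frac{8K_2D\eta}{\sigma\sqrt\pi}\,\Gamma\!\left(1+\tfrac1\alpha\right)\left(1-2\eta m+\eta^2K_1^2\right)^{p/2},$$ $$C_7=\frac{4K_2D\eta}{\sigma}\left(\frac{2}{\sqrt\pi}\,\Gamma\!\left(1+\tfrac1\alpha\right)\left(\sqrt2+(2\eta K)^{p/2}\right)+\frac{\Gamma\left(\frac{1+\alpha-p}{\alpha}\right)}{\Gamma\left(\frac{3-p}{2}\right)}\,\sigma^p\,2^{p/2}\left(\frac{\Gamma(p+\frac d2)}{\Gamma(\frac d2)}\right)^{1/2}\right).$$ -/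

import Mathlib

open MeasureTheory ProbabilityTheory
open scoped ENNReal

namespace HeavyTailedGD

noncomputable section

/-- A probability measure on `ℝ^d` is rotationally invariant `α`-stable (with unit scale) if its
characteristic function is `u ↦ exp (-‖u‖ ^ α)`. -/
def IsRotInvStable {d : ℕ} (α : ℝ) (ν : Measure (EuclideanSpace ℝ (Fin d))) : Prop :=
  ∀ u, charFun ν u = ((Real.exp (-(‖u‖ ^ α)) : ℝ) : ℂ)

/-- Pseudo-Lipschitz gradients: for every `x ∈ 𝒳` the loss `f (·, x)` is differentiable, and
`‖∇f(θ,x) - ∇f(θ',x')‖ ≤ K₁ ‖θ - θ'‖ + K₂ ‖x - x'‖ (‖θ‖ + ‖θ'‖ + 1)`. -/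
structure PseudoLipschitzGradient {d : ℕ} {S : Type*} [NormedAddCommGroup S]
    (f : EuclideanSpace ℝ (Fin d) → S → ℝ) (𝒳 : Set S) (K₁ K₂ : ℝ) : Prop where
  K₁_pos : 0 < K₁
  K₂_pos : 0 < K₂
  differentiable : ∀ x ∈ 𝒳, Differentiable ℝ (fun θ => f θ x)
  bound : ∀ θ θ' : EuclideanSpace ℝ (Fin d), ∀ x ∈ 𝒳, ∀ x' ∈ 𝒳,
    ‖gradient (fun w => f w x) θ - gradient (fun w => f w x') θ'‖
      ≤ K₁ * ‖θ - θ'‖ + K₂ * ‖x - x'‖ * (‖θ‖ + ‖θ'‖ + 1)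

/-- Uniform dissipativity of the loss, with bounded gradients at the origin. -/
structure UniformlyDissipative {d : ℕ} {S : Type*}
    (f : EuclideanSpace ℝ (Fin d) → S → ℝ) (𝒳 : Set S) (B m K : ℝ) : Prop where
  B_pos : 0 < B
  m_pos : 0 < m
  K_pos : 0 < K
  gradient_zero_le : ∀ x ∈ 𝒳, ‖gradient (fun w => f w x) 0‖ ≤ B
  dissipative : ∀ θ₁ θ₂ : EuclideanSpace ℝ (Fin d), ∀ x ∈ 𝒳,
    m * ‖θ₁ - θ₂‖ ^ 2 - K
      ≤ inner ℝ (gradient (fun w => f w x) θ₁ - gradient (fun w => f w x) θ₂) (θ₁ - θ₂)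

/-- `ϑ` is a universal stable point: every `f (·, x)`, `x ∈ 𝒳`, has vanishing gradient there. -/
def IsUniversalStablePoint {d : ℕ} {S : Type*}
    (f : EuclideanSpace ℝ (Fin d) → S → ℝ) (𝒳 : Set S) (ϑ : EuclideanSpace ℝ (Fin d)) : Prop :=
  ∀ x ∈ 𝒳, gradient (fun w => f w x) ϑ = 0

/-- Two data sets of size `n` are neighboring if they agree except possibly at one index. -/
def Neighboring {S : Type*} {n : ℕ} (X Y : Fin n → S) : Prop :=
  ∃ i, ∀ j, j ≠ i → X j = Y j

/-- The empirical risk `F(θ, X) = (1/n) ∑ᵢ f(θ, xᵢ)`. -/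
def empiricalRisk {d n : ℕ} {S : Type*} (f : EuclideanSpace ℝ (Fin d) → S → ℝ)
    (X : Fin n → S) (θ : EuclideanSpace ℝ (Fin d)) : ℝ :=
  (1 / (n : ℝ)) * ∑ i, f θ (X i)

theorem measurable_gradient {d : ℕ} (g : EuclideanSpace ℝ (Fin d) → ℝ) :
    Measurable (gradient g) :=
  (InnerProductSpace.toDual ℝ (EuclideanSpace ℝ (Fin d))).symm.continuous.measurable.comp
    (measurable_fderiv ℝ g)

/-- One step of noisy gradient descent: `θ - η ∇F(θ, X) + σ z`. -/
def gdStep {d n : ℕ} {S : Type*} (f : EuclideanSpace ℝ (Fin d) → S → ℝ) (η σ : ℝ)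
    (X : Fin n → S) (θ z : EuclideanSpace ℝ (Fin d)) : EuclideanSpace ℝ (Fin d) :=
  θ - η • gradient (empiricalRisk f X) θ + σ • z

theorem measurable_gdStep {d n : ℕ} {S : Type*} (f : EuclideanSpace ℝ (Fin d) → S → ℝ)
    (η σ : ℝ) (X : Fin n → S) :
    Measurable (fun q : EuclideanSpace ℝ (Fin d) × EuclideanSpace ℝ (Fin d) =>
      gdStep f η σ X q.1 q.2) := by
  unfold gdStep
  exact (measurable_fst.sub (((measurable_gradient _).comp measurable_fst).const_smul η)).add
    (measurable_snd.const_smul σ)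

/-- The transition kernel of the noisy gradient descent chain
`θ_k = θ_{k-1} - η ∇F(θ_{k-1}, X) + σ ξ_k` with i.i.d. noise `ξ_k` of law `ν`:
`P(θ, ·)` is the law of `θ - η ∇F(θ, X) + σ ξ` for `ξ` of law `ν`. -/
def gdKernel {d n : ℕ} {S : Type*} (f : EuclideanSpace ℝ (Fin d) → S → ℝ) (η σ : ℝ)
    (ν : Measure (EuclideanSpace ℝ (Fin d))) [SFinite ν] (X : Fin n → S) :
    Kernel (EuclideanSpace ℝ (Fin d)) (EuclideanSpace ℝ (Fin d)) where
  toFun θ := ν.map (gdStep f η σ X θ)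
  measurable' := by
    refine Measure.measurable_of_measurable_coe _ fun s hs => ?_
    have h : ∀ θ, (ν.map (gdStep f η σ X θ)) s
        = ν (Prod.mk θ ⁻¹' ((fun q : EuclideanSpace ℝ (Fin d) × EuclideanSpace ℝ (Fin d) =>
            gdStep f η σ X q.1 q.2) ⁻¹' s)) := fun θ =>
      Measure.map_apply ((measurable_gdStep f η σ X).comp measurable_prodMk_left) hs
    simp only [h]
    exact measurable_measure_prodMk_left (measurable_gdStep f η σ X hs)

/-- The Lyapunov function `V_p(θ) = (1 + ‖θ - ϑ‖²)^{p/2}`. -/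
def lyapunov {d : ℕ} (ϑ : EuclideanSpace ℝ (Fin d)) (p : ℝ) (θ : EuclideanSpace ℝ (Fin d)) : ℝ :=
  (1 + ‖θ - ϑ‖ ^ 2) ^ (p / 2)

/-- The `V`-norm `‖μ - ν‖_V`: the supremum of `|∫ g dμ - ∫ g dν|` over measurable `g` with
`|g| ≤ V`. It is meant for `V` integrable with respect to both measures. -/
def vNorm {d : ℕ} (V : EuclideanSpace ℝ (Fin d) → ℝ)
    (μ ν : Measure (EuclideanSpace ℝ (Fin d))) : ℝ≥0∞ :=
  ⨆ (g : EuclideanSpace ℝ (Fin d) → ℝ) (_ : Measurable g) (_ : ∀ y, |g y| ≤ V y),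
    ENNReal.ofReal |(∫ y, g y ∂μ) - ∫ y, g y ∂ν|

/-- The explicit constant `C_γ`; it does not depend on the number of data points. -/
def cGamma (d : ℕ) (α p η σ m K K₁ K₂ D : ℝ) (ϑ : EuclideanSpace ℝ (Fin d)) : ℝ :=
  let C₁ := 2 * K₂ * D * η / σ
  let C₂ := 2 / √Real.pi * Real.Gamma (1 + 1 / α)
  let C₃ := Real.Gamma ((1 + α - p) / α) / Real.Gamma ((3 - p) / 2)
  let C₄ := 2 * C₁ * C₂
  let C₅ := 2 * C₁ * C₃
  let Cp := (2 : ℝ) ^ p * (Real.Gamma (p + (d : ℝ) / 2) / Real.Gamma ((d : ℝ) / 2))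
  let C₆ := C₄ * (1 - 2 * η * m + η ^ 2 * K₁ ^ 2) ^ (p / 2)
  let C₇ := C₄ * √2 + C₄ * (2 * η * K) ^ (p / 2) + C₅ * σ ^ p * √Cp
  (C₆ + C₇) * (2 + ‖ϑ‖)

end

end HeavyTailedGD

/-!
The stable law `ν` is the law of `√(2S) Z` with `Z` standard Gaussian and `S` independent of `Z` and
one-sided `α/2`-stable, as a comparison of characteristic functions with the Laplace transform of
`S` shows. Conditionally on `S`, the laws `P(θ, ·)` and `P̂(θ, ·)` are therefore Gaussians with the
same covariance and different centres. Differentiating the Gaussian density along the segment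
between the centres and applying the Cauchy–Schwarz inequality bounds their `V`-distance by the
distance of the centres divided by `σ√(2S)`, times the size of `V` near the segment; averaging over
`S` leaves negative moments of `S`, which the Laplace transform expresses through Gamma functions.

The two centres are gradient steps for neighbouring data, so they are at distance
`O((1 + ‖θ‖) / n)`. Dissipativity puts both of them in one ball around the stable point, with radius
controlled by `‖θ - ϑ‖`; this ball is convex and hence contains the segment between them, so that
`V` is at most a multiple of `V(θ)` there.
-/

namespace HeavyTailedGD

open Filter Topology Set

noncomputable section

/-! ### Laplace transforms -/

section RadialLaplace

variable {E : Type*} [NormedAddCommGroup E]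

theorem exp_neg_mul_norm_le_one {l : ℝ} (hl : 0 ≤ l) (x : E) : Real.exp (-(l * ‖x‖)) ≤ 1 :=
  Real.exp_le_one_iff.2 (neg_nonpos.2 (by positivity))

variable [MeasurableSpace E]

/-- The Laplace transform `l ↦ ∫ e^{-l ‖x‖} dμ` of the law of the norm under `μ`. -/
def radialLaplace (μ : Measure E) (l : ℝ) : ℝ := ∫ x, Real.exp (-(l * ‖x‖)) ∂μ

variable [BorelSpace E]

theorem integrable_exp_neg_mul_norm (μ : Measure E) [IsFiniteMeasure μ] {l : ℝ} (hl : 0 ≤ l) :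
    Integrable (fun x => Real.exp (-(l * ‖x‖))) μ :=
  .of_bound (Measurable.aestronglyMeasurable (by fun_prop)) 1 <| .of_forall fun x => by
    rw [Real.norm_of_nonneg (Real.exp_pos _).le]
    exact exp_neg_mul_norm_le_one hl x

theorem one_sub_radialLaplace (μ : Measure E) [IsProbabilityMeasure μ] {l : ℝ} (hl : 0 ≤ l) :
    1 - radialLaplace μ l = ∫ x, (1 - Real.exp (-(l * ‖x‖))) ∂μ := by
  rw [integral_sub (integrable_const _) (integrable_exp_neg_mul_norm μ hl), radialLaplace]
  simp

theorem measureReal_norm_gt_le_radialLaplace (μ : Measure E) [IsProbabilityMeasure μ] {r : ℝ}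
    (hr : 0 < r) :
    μ.real {x | r < ‖x‖} ≤ (1 - radialLaplace μ r⁻¹) / (1 - Real.exp (-1)) := by
  have hr' : 0 ≤ r⁻¹ := inv_nonneg.2 hr.le
  have hpos : 0 < 1 - Real.exp (-1) := sub_pos.2 (Real.exp_lt_one_iff.2 (by norm_num))
  have markov := mul_meas_ge_le_integral_of_nonneg (μ := μ)
    (.of_forall fun x => sub_nonneg.2 (exp_neg_mul_norm_le_one hr' x))
    ((integrable_const _).sub (integrable_exp_neg_mul_norm μ hr')) (1 - Real.exp (-1))
  rw [le_div_iff₀ hpos, mul_comm, one_sub_radialLaplace μ hr']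
  refine (mul_le_mul_of_nonneg_left (measureReal_mono fun x (hx : r < ‖x‖) => ?_) hpos.le).trans
    markov
  have : 1 ≤ r⁻¹ * ‖x‖ := by
    rw [inv_mul_eq_div, le_div_iff₀ hr, one_mul]
    exact hx.le
  simp only [mem_ofPred_eq]
  gcongr

theorem tendsto_radialLaplace_of_tendsto {ι : Type*} {L : Filter ι}
    {M : ι → ProbabilityMeasure E} {μ : ProbabilityMeasure E} (h : Tendsto M L (𝓝 μ)) {l : ℝ}
    (hl : 0 ≤ l) :
    Tendsto (fun i => radialLaplace (M i : Measure E) l) L (𝓝 (radialLaplace (μ : Measure E) l)) :=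
  ProbabilityMeasure.tendsto_iff_forall_integral_tendsto.1 h <|
    .ofNormedAddCommGroup (fun x => Real.exp (-(l * ‖x‖))) (by fun_prop) 1 fun x => by
      rw [Real.norm_of_nonneg (Real.exp_pos _).le]
      exact exp_neg_mul_norm_le_one hl x

theorem isTightMeasureSet_range_of_tendsto_radialLaplace [ProperSpace E]
    {M : ℕ → ProbabilityMeasure E} {φ : ℝ → ℝ}
    (hM : ∀ l, 0 < l → Tendsto (fun n => radialLaplace (M n : Measure E) l) atTop (𝓝 (φ l)))
    (hφ : Tendsto φ (𝓝[>] 0) (𝓝 1)) :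
    IsTightMeasureSet (range fun n => (M n : Measure E)) := by
  have hlim : Tendsto (fun r : ℝ => ENNReal.ofReal ((1 - φ r⁻¹) / (1 - Real.exp (-1)))) atTop
      (𝓝 0) := by
    simpa using ENNReal.tendsto_ofReal
      (((hφ.comp tendsto_inv_atTop_nhdsGT_zero).const_sub 1).div_const (1 - Real.exp (-1)))
  refine isTightMeasureSet_range_of_tendsto_limsup_measure_norm_gt <|
    tendsto_of_tendsto_of_tendsto_of_le_of_le' tendsto_const_nhds hlim (.of_forall fun _ => zero_le)
      ((eventually_gt_atTop 0).mono fun r hr => ?_)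
  have htail : Tendsto (fun n => ENNReal.ofReal
      ((1 - radialLaplace (M n : Measure E) r⁻¹) / (1 - Real.exp (-1)))) atTop
      (𝓝 (ENNReal.ofReal ((1 - φ r⁻¹) / (1 - Real.exp (-1))))) :=
    ENNReal.tendsto_ofReal (((hM _ (inv_pos.2 hr)).const_sub 1).div_const _)
  refine (limsup_le_limsup (.of_forall fun n => ?_)).trans_eq htail.limsup_eq
  rw [← ofReal_measureReal]
  exact ENNReal.ofReal_le_ofReal (measureReal_norm_gt_le_radialLaplace _ hr)

theorem exists_radialLaplace_eq_of_tendsto [ProperSpace E] {M : ℕ → ProbabilityMeasure E}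
    {φ : ℝ → ℝ}
    (hM : ∀ l, 0 < l → Tendsto (fun n => radialLaplace (M n : Measure E) l) atTop (𝓝 (φ l)))
    (hφ : Tendsto φ (𝓝[>] 0) (𝓝 1)) :
    ∃ μ : ProbabilityMeasure E, ∀ l, 0 < l → radialLaplace (μ : Measure E) l = φ l := by
  have hcompact : IsCompact (closure (range M)) := isCompact_closure_of_isTightMeasureSet <| by
    simpa only [exists_range_iff] using! isTightMeasureSet_range_of_tendsto_radialLaplace hM hφ
  obtain ⟨μ, -, hμ⟩ := hcompact.ultrafilter_le_nhds' ((hyperfilter ℕ).map M)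
    (Ultrafilter.mem_map.2 (univ_mem' fun n => subset_closure (mem_range_self n)))
  have hle : (hyperfilter ℕ : Filter ℕ) ≤ atTop := Nat.cofinite_eq_atTop ▸ hyperfilter_le_cofinite
  exact ⟨μ, fun l hl => tendsto_nhds_unique (tendsto_radialLaplace_of_tendsto hμ hl.le)
    ((hM l hl).mono_left hle)⟩

theorem lintegral_norm_rpow_lt_top_of_one_sub_radialLaplace_le {μ : Measure E}
    [IsProbabilityMeasure μ] {a q : ℝ} (hq : 0 < q) (hqa : q < a)
    (hμ : ∀ l, 0 < l → 1 - radialLaplace μ l ≤ l ^ a) :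
    ∫⁻ x, ENNReal.ofReal (‖x‖ ^ q) ∂μ < ∞ := by
  have htail : ∀ t ∈ Ioi (1 : ℝ), μ {x | t < ‖x‖} * ENNReal.ofReal (t ^ (q - 1))
      ≤ ENNReal.ofReal ((1 - Real.exp (-1))⁻¹ * t ^ (q - 1 + -a)) := fun t ht => by
    have ht0 : 0 < t := one_pos.trans ht
    have hpos : 0 < 1 - Real.exp (-1) := sub_pos.2 (Real.exp_lt_one_iff.2 (by norm_num))
    rw [← ofReal_measureReal, ← ENNReal.ofReal_mul measureReal_nonneg]
    refine ENNReal.ofReal_le_ofReal ?_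
    calc μ.real {x | t < ‖x‖} * t ^ (q - 1)
        ≤ t⁻¹ ^ a / (1 - Real.exp (-1)) * t ^ (q - 1) := by
          gcongr
          refine (measureReal_norm_gt_le_radialLaplace μ ht0).trans ?_
          gcongr
          exact hμ _ (inv_pos.2 ht0)
      _ = (1 - Real.exp (-1))⁻¹ * t ^ (q - 1 + -a) := by
          rw [Real.rpow_add ht0, Real.rpow_neg ht0.le, Real.inv_rpow ht0.le]
          ring
  rw [lintegral_rpow_eq_lintegral_meas_lt_mul μ (.of_forall fun x => norm_nonneg x)
    (by fun_prop) hq, ← Ioc_union_Ioi_eq_Ioi (zero_le_one (α := ℝ))]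
  refine ENNReal.mul_lt_top ENNReal.ofReal_lt_top ((lintegral_union_le _ _ _).trans_lt
    (ENNReal.add_lt_top.2 ⟨?_, ?_⟩))
  · refine (lintegral_mono fun t => mul_le_of_le_one_left zero_le prob_le_one).trans_lt ?_
    refine IntegrableOn.setLIntegral_lt_top ?_
    rw [integrableOn_Ioc_iff_integrableOn_Ioo]
    exact (intervalIntegral.integrableOn_Ioo_rpow_iff one_pos).2 (by linarith)
  · refine (setLIntegral_mono (by fun_prop) htail).trans_lt ?_
    have : IntegrableOn (fun t : ℝ => (1 - Real.exp (-1))⁻¹ * t ^ (q - 1 + -a)) (Ioi 1) :=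
      (integrableOn_Ioi_rpow_of_lt (by linarith) one_pos).const_mul _
    exact this.setLIntegral_lt_top

theorem measureReal_singleton_zero_le_radialLaplace (μ : Measure E) [IsFiniteMeasure μ] {l : ℝ}
    (hl : 0 ≤ l) : μ.real {0} ≤ radialLaplace μ l := by
  have markov := mul_meas_ge_le_integral_of_nonneg (μ := μ)
    (.of_forall fun x => (Real.exp_pos (-(l * ‖x‖))).le) (integrable_exp_neg_mul_norm μ hl) 1
  rw [one_mul] at markov
  exact (measureReal_mono fun x hx => by simp [eq_of_mem_singleton hx]).trans markov

theorem ae_ne_zero_of_tendsto_radialLaplace {μ : Measure E} [IsFiniteMeasure μ]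
    (h : Tendsto (radialLaplace μ) atTop (𝓝 0)) : ∀ᵐ x ∂μ, x ≠ 0 := by
  rw [ae_iff]
  simp only [not_not, ofPred_eq_eq_singleton]
  rw [← measureReal_eq_zero_iff]
  exact (ge_of_tendsto h ((eventually_ge_atTop 0).mono fun l hl =>
    measureReal_singleton_zero_le_radialLaplace μ hl)).antisymm measureReal_nonneg

theorem ofReal_rpow_neg_eq_lintegral {r s : ℝ} (hr : 0 < r) (hs : 0 < s) :
    ENNReal.ofReal (s ^ (-r)) = ENNReal.ofReal (Real.Gamma r)⁻¹ *
      ∫⁻ l in Ioi (0 : ℝ), ENNReal.ofReal (l ^ (r - 1) * Real.exp (-(l * s))) := by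
  have := Real.Gamma_pos_of_pos hr
  have hint : IntegrableOn (fun l : ℝ => l ^ (r - 1) * Real.exp (-(l * s))) (Ioi 0) := by
    refine (integrableOn_rpow_mul_exp_neg_mul_rpow (s := r - 1) (by linarith) one_pos hs).congr_fun
      (fun l _ => ?_) measurableSet_Ioi
    simp only [Real.rpow_one, neg_mul, mul_comm s l]
  have hval : ∫ l in Ioi (0 : ℝ), l ^ (r - 1) * Real.exp (-(l * s)) = s ^ (-r) * Real.Gamma r := by
    simp_rw [mul_comm _ s]
    rw [Real.integral_rpow_mul_exp_neg_mul_Ioi hr hs, one_div, Real.inv_rpow hs.le,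
      Real.rpow_neg hs.le]
  rw [← ofReal_integral_eq_lintegral_ofReal hint
    (ae_restrict_of_forall_mem measurableSet_Ioi fun l (hl : 0 < l) => by positivity), hval,
    ← ENNReal.ofReal_mul (by positivity)]
  congr 1
  field_simp

theorem lintegral_norm_rpow_neg {μ : Measure E} [IsFiniteMeasure μ] (hμ : ∀ᵐ x ∂μ, x ≠ 0)
    {r : ℝ} (hr : 0 < r) :
    ∫⁻ x, ENNReal.ofReal (‖x‖ ^ (-r)) ∂μ = ENNReal.ofReal (Real.Gamma r)⁻¹ *
      ∫⁻ l in Ioi (0 : ℝ), ENNReal.ofReal (l ^ (r - 1) * radialLaplace μ l) := by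
  have hinner : ∀ l ∈ Ioi (0 : ℝ),
      ∫⁻ x, ENNReal.ofReal (l ^ (r - 1) * Real.exp (-(l * ‖x‖))) ∂μ
        = ENNReal.ofReal (l ^ (r - 1) * radialLaplace μ l) := fun l (hl : 0 < l) => by
    rw [← ofReal_integral_eq_lintegral_ofReal ((integrable_exp_neg_mul_norm μ hl.le).const_mul _)
      (.of_forall fun x => by positivity), integral_const_mul, radialLaplace]
  rw [lintegral_congr_ae (hμ.mono fun x hx => ofReal_rpow_neg_eq_lintegral hr (norm_pos_iff.2 hx)),
    lintegral_const_mul' _ _ ENNReal.ofReal_ne_top, lintegral_lintegral_swap (by fun_prop),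
    setLIntegral_congr_fun measurableSet_Ioi hinner]

theorem radialLaplace_map_norm (μ : Measure E) (l : ℝ) :
    radialLaplace (μ.map norm) l = radialLaplace μ l := by
  rw [radialLaplace, integral_map (by fun_prop) (Measurable.aestronglyMeasurable (by fun_prop))]
  simp only [norm_norm, radialLaplace]

/-- The law of `c (‖x₁‖ + ⋯ + ‖xₙ‖)` for i.i.d. `xᵢ` of law `μ`. -/
def scaledNormSumLaw (μ : Measure E) (c : ℝ) (n : ℕ) : Measure ℝ :=
  (Measure.pi fun _ : Fin n => μ).map (fun x => c * ∑ i, ‖x i‖)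

theorem isProbabilityMeasure_scaledNormSumLaw (μ : Measure E) [IsProbabilityMeasure μ] (c : ℝ)
    (n : ℕ) : IsProbabilityMeasure (scaledNormSumLaw μ c n) :=
  Measure.isProbabilityMeasure_map (Measurable.aemeasurable (by fun_prop))

theorem radialLaplace_scaledNormSumLaw (μ : Measure E) [IsProbabilityMeasure μ] {c : ℝ}
    (hc : 0 ≤ c) (n : ℕ) (l : ℝ) :
    radialLaplace (scaledNormSumLaw μ c n) l = radialLaplace μ (l * c) ^ n := by
  have hprod := integral_fintype_prod_eq_pow (𝕜 := ℝ) (ι := Fin n) (μ := μ)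
    (fun x => Real.exp (-(l * c * ‖x‖)))
  rw [Fintype.card_fin] at hprod
  rw [radialLaplace, radialLaplace, scaledNormSumLaw, ← hprod,
    integral_map (Measurable.aemeasurable (by fun_prop))
      (Measurable.aestronglyMeasurable (by fun_prop))]
  congr 1 with x
  rw [Real.norm_of_nonneg (by positivity), ← Real.exp_sum, Finset.sum_neg_distrib,
    ← Finset.mul_sum, mul_assoc]

end RadialLaplace

theorem tendsto_pow_exp_neg_rpow {φ : ℝ → ℝ} {a κ l : ℝ} (ha : 0 < a) (hκ : 0 < κ)
    (h : Tendsto (fun l => (1 - φ l) / l ^ a) (𝓝[>] 0) (𝓝 κ)) (hl : 0 < l) :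
    Tendsto (fun n : ℕ => φ (l * (n * κ) ^ (-a⁻¹)) ^ n) atTop
      (𝓝 (Real.exp (-(l ^ a)))) := by
  have hscale : Tendsto (fun n : ℕ => l * ((n : ℝ) * κ) ^ (-a⁻¹)) atTop (𝓝[>] 0) := by
    refine tendsto_nhdsWithin_iff.2 ⟨?_, (eventually_gt_atTop 0).mono fun n hn =>
      mem_Ioi.2 (by positivity)⟩
    simpa using ((tendsto_rpow_neg_atTop (inv_pos.2 ha)).comp
      (tendsto_natCast_atTop_atTop.atTop_mul_const hκ)).const_mul l
  have hexp : Tendsto (fun n : ℕ => (n : ℝ) * (φ (l * (n * κ) ^ (-a⁻¹)) - 1)) atTop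
      (𝓝 (-(l ^ a))) := by
    have hlim := ((h.comp hscale).const_mul (l ^ a / κ)).neg
    rw [div_mul_cancel₀ _ hκ.ne'] at hlim
    refine hlim.congr' ((eventually_gt_atTop 0).mono fun n hn => ?_)
    have hpow : (l * ((n : ℝ) * κ) ^ (-a⁻¹)) ^ a = l ^ a * (n * κ)⁻¹ := by
      rw [Real.mul_rpow hl.le (by positivity), ← Real.rpow_mul (by positivity), neg_mul,
        inv_mul_cancel₀ ha.ne', Real.rpow_neg_one]
    have : (n : ℝ) ≠ 0 := by positivity
    simp only [Function.comp_apply, hpow]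
    field_simp
    ring
  exact (Real.tendsto_one_add_pow_exp_of_tendsto hexp).congr fun n => by rw [add_sub_cancel]

/-! ### One-sided stable laws -/

/-- The density `(1 - e^{-x}) x^{-(1+q)}` whose integral over `(0, ∞)` normalizes the Lévy measure
of the one-sided `q`-stable law. -/
def levyIntegrand (q x : ℝ) : ℝ := (1 - Real.exp (-x)) * x ^ (-(1 + q))

theorem measurable_levyIntegrand (q : ℝ) : Measurable (levyIntegrand q) := by
  unfold levyIntegrand
  fun_prop

theorem levyIntegrand_pos (q : ℝ) {x : ℝ} (hx : 0 < x) : 0 < levyIntegrand q x :=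
  mul_pos (sub_pos.2 (Real.exp_lt_one_iff.2 (neg_lt_zero.2 hx))) (Real.rpow_pos_of_pos hx _)

theorem integrableOn_levyIntegrand {q : ℝ} (hq : 0 < q) (hq' : q < 1) :
    IntegrableOn (levyIntegrand q) (Ioi 0) := by
  have hm := (measurable_levyIntegrand q).aestronglyMeasurable (μ := volume)
  have near_zero : IntegrableOn (levyIntegrand q) (Ioc 0 1) := by
    have hdom : IntegrableOn (fun x : ℝ => x ^ (-q)) (Ioc 0 1) := by
      rw [integrableOn_Ioc_iff_integrableOn_Ioo]
      exact (intervalIntegral.integrableOn_Ioo_rpow_iff one_pos).2 (by linarith)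
    refine hdom.mono' hm.restrict (ae_restrict_of_forall_mem measurableSet_Ioc fun x hx => ?_)
    have hx0 : 0 < x := hx.1
    rw [Real.norm_of_nonneg (levyIntegrand_pos q hx0).le]
    calc (1 - Real.exp (-x)) * x ^ (-(1 + q)) ≤ x * x ^ (-(1 + q)) := by
          gcongr
          linarith [Real.add_one_le_exp (-x)]
      _ = x ^ (-q) := by
          rw [← Real.rpow_one_add' hx0.le (by linarith), neg_add, add_neg_cancel_left]
  have near_top : IntegrableOn (levyIntegrand q) (Ioi 1) := by
    refine (integrableOn_Ioi_rpow_of_lt (a := -(1 + q)) (by linarith) one_pos).mono' hm.restrict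
      (ae_restrict_of_forall_mem measurableSet_Ioi fun x (hx : 1 < x) => ?_)
    have hx0 : 0 < x := one_pos.trans hx
    rw [Real.norm_of_nonneg (levyIntegrand_pos q hx0).le]
    exact mul_le_of_le_one_left (by positivity) (by linarith [Real.exp_pos (-x)])
  rw [← Ioc_union_Ioi_eq_Ioi (zero_le_one (α := ℝ))]
  exact near_zero.union near_top

theorem integral_levyIntegrand_pos {q : ℝ} (hq : 0 < q) (hq' : q < 1) :
    0 < ∫ x in Ioi (0 : ℝ), levyIntegrand q x := by
  refine (setIntegral_pos_iff_support_of_nonneg_ae (ae_restrict_of_forall_mem measurableSet_Ioi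
    fun x hx => (levyIntegrand_pos q hx).le) (integrableOn_levyIntegrand hq hq')).2 ?_
  have hsupp : Function.support (levyIntegrand q) ∩ Ioi 0 = Ioi 0 :=
    inter_eq_right.2 fun x hx => (levyIntegrand_pos q hx).ne'
  simp [hsupp]

theorem tendsto_integral_Ioi_levyIntegrand {q : ℝ} (hq : 0 < q) (hq' : q < 1) :
    Tendsto (fun l => ∫ x in Ioi l, levyIntegrand q x) (𝓝[>] 0)
      (𝓝 (∫ x in Ioi (0 : ℝ), levyIntegrand q x)) := by
  have hcover : AECover (volume.restrict (Ioi (0 : ℝ))) (𝓝[>] 0) Ioi :=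
    aecover_Ioi_of_Ioi (tendsto_id.mono_left nhdsWithin_le_nhds)
  refine (hcover.integral_tendsto_of_countably_generated (integrableOn_levyIntegrand hq hq')).congr'
    (eventually_mem_nhdsWithin.mono fun l (hl : 0 < l) => ?_)
  rw [Measure.restrict_restrict measurableSet_Ioi, inter_eq_left.2 (Ioi_subset_Ioi hl.le)]

theorem one_sub_radialLaplace_paretoMeasure {a l : ℝ} (ha : 0 < a) (hl : 0 < l) :
    1 - radialLaplace (paretoMeasure 1 a) l = a * l ^ a * ∫ y in Ioi l, levyIntegrand a y := by
  have : IsProbabilityMeasure (paretoMeasure 1 a) := isProbabilityMeasure_paretoMeasure one_pos ha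
  have hdensity : ∀ x, (paretoPDF 1 a x).toReal • (1 - Real.exp (-(l * ‖x‖)))
      = (Ici (1 : ℝ)).indicator (fun x => a * l ^ (1 + a) * levyIntegrand a (l * x)) x := by
    intro x
    by_cases hx : 1 ≤ x
    · have hx0 : 0 < x := one_pos.trans_le hx
      rw [indicator_of_mem (show x ∈ Ici 1 from hx), paretoPDF_of_le hx,
        ENNReal.toReal_ofReal (by positivity), levyIntegrand, Real.norm_of_nonneg hx0.le,
        Real.mul_rpow hl.le hx0.le, Real.one_rpow, smul_eq_mul, add_comm 1 a, Real.rpow_neg hl.le]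
      field_simp
    · rw [indicator_of_notMem (show x ∉ Ici 1 from hx), paretoPDF_of_lt (not_le.1 hx)]
      simp
  rw [one_sub_radialLaplace _ hl.le, paretoMeasure, integral_withDensity_eq_integral_toReal_smul
    (by unfold paretoPDF; fun_prop) (.of_forall fun x => by simp [paretoPDF])]
  simp_rw [hdensity]
  rw [integral_indicator measurableSet_Ici, integral_Ici_eq_integral_Ioi, integral_const_mul,
    integral_comp_mul_left_Ioi _ _ hl, mul_one, smul_eq_mul, Real.rpow_add hl, Real.rpow_one]
  field_simp

theorem tendsto_one_sub_radialLaplace_paretoMeasure {a : ℝ} (ha : 0 < a) (ha' : a < 1) :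
    Tendsto (fun l => (1 - radialLaplace (paretoMeasure 1 a) l) / l ^ a) (𝓝[>] 0)
      (𝓝 (a * ∫ y in Ioi (0 : ℝ), levyIntegrand a y)) := by
  refine ((tendsto_integral_Ioi_levyIntegrand ha ha').const_mul a).congr'
    (eventually_mem_nhdsWithin.mono fun l (hl : 0 < l) => ?_)
  simp only [one_sub_radialLaplace_paretoMeasure ha hl]
  field_simp

/-- One-sided `a`-stable laws: laws on `(0, ∞)` with Laplace transform `l ↦ e^{-l^a}`. For `a = 1`
this is the Dirac mass at `1`. -/
structure IsOneSidedStable (a : ℝ) (μ : Measure ℝ) : Prop where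
  ae_pos : ∀ᵐ s ∂μ, 0 < s
  radialLaplace_eq : ∀ l, 0 < l → radialLaplace μ l = Real.exp (-(l ^ a))

theorem isOneSidedStable_map_norm {E : Type*} [NormedAddCommGroup E] [MeasurableSpace E]
    [BorelSpace E] {a : ℝ} (ha : 0 < a) {μ : Measure E} [IsFiniteMeasure μ]
    (hμ : ∀ l, 0 < l → radialLaplace μ l = Real.exp (-(l ^ a))) :
    IsOneSidedStable a (μ.map norm) where
  ae_pos := by
    have hlim : Tendsto (radialLaplace μ) atTop (𝓝 0) :=
      (Real.tendsto_exp_neg_atTop_nhds_zero.comp (tendsto_rpow_atTop ha)).congr'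
        ((eventually_gt_atTop 0).mono fun l hl => (hμ l hl).symm)
    rw [ae_map_iff (by fun_prop) measurableSet_Ioi]
    exact (ae_ne_zero_of_tendsto_radialLaplace hlim).mono fun x hx => norm_pos_iff.2 hx
  radialLaplace_eq l hl := (radialLaplace_map_norm μ l).trans (hμ l hl)

theorem isOneSidedStable_one_dirac : IsOneSidedStable 1 (Measure.dirac 1) where
  ae_pos := by simp
  radialLaplace_eq l _ := by simp [radialLaplace]

/-- Existence comes from a stable limit theorem: normalized sums of i.i.d. Pareto variables converge
to the `a`-stable law, by convergence of their Laplace transforms. -/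
theorem exists_isOneSidedStable {a : ℝ} (ha : 0 < a) (ha' : a ≤ 1) :
    ∃ μ : ProbabilityMeasure ℝ, IsOneSidedStable a (μ : Measure ℝ) := by
  rcases ha'.eq_or_lt with rfl | ha'
  · exact ⟨⟨Measure.dirac 1, inferInstance⟩, isOneSidedStable_one_dirac⟩
  have : IsProbabilityMeasure (paretoMeasure 1 a) := isProbabilityMeasure_paretoMeasure one_pos ha
  set κ := a * ∫ y in Ioi (0 : ℝ), levyIntegrand a y
  have hκ : 0 < κ := mul_pos ha (integral_levyIntegrand_pos ha ha')
  let M : ℕ → ProbabilityMeasure ℝ := fun n =>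
    ⟨scaledNormSumLaw (paretoMeasure 1 a) ((n * κ) ^ (-a⁻¹)) n,
      isProbabilityMeasure_scaledNormSumLaw _ _ n⟩
  have hM : ∀ l, 0 < l →
      Tendsto (fun n => radialLaplace (M n : Measure ℝ) l) atTop (𝓝 (Real.exp (-(l ^ a)))) :=
    fun l hl => (tendsto_pow_exp_neg_rpow ha hκ
      (tendsto_one_sub_radialLaplace_paretoMeasure ha ha') hl).congr fun n =>
        (radialLaplace_scaledNormSumLaw _ (by positivity) n l).symm
  have hφ : Tendsto (fun l : ℝ => Real.exp (-(l ^ a))) (𝓝[>] 0) (𝓝 1) := by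
    have := (Real.continuous_exp.comp (Real.continuous_rpow_const ha.le).neg).tendsto 0
    simpa [Function.comp_def, Real.zero_rpow ha.ne'] using this.mono_left nhdsWithin_le_nhds
  obtain ⟨μ, hμ⟩ := exists_radialLaplace_eq_of_tendsto hM hφ
  exact ⟨μ.map measurable_norm.aemeasurable, isOneSidedStable_map_norm ha hμ⟩

namespace IsOneSidedStable

variable {a : ℝ} {μ : Measure ℝ} [IsProbabilityMeasure μ]

theorem lintegral_rpow_neg (hμ : IsOneSidedStable a μ) (ha : 0 < a) {r : ℝ} (hr : 0 ≤ r) :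
    ∫⁻ s, ENNReal.ofReal (s ^ (-r)) ∂μ
      = ENNReal.ofReal (Real.Gamma (1 + r / a) / Real.Gamma (1 + r)) := by
  rcases hr.eq_or_lt with rfl | hr
  · simp
  have hΓ := Real.Gamma_pos_of_pos hr
  have hnorm : ∫⁻ s, ENNReal.ofReal (s ^ (-r)) ∂μ = ∫⁻ s, ENNReal.ofReal (‖s‖ ^ (-r)) ∂μ :=
    lintegral_congr_ae (hμ.ae_pos.mono fun s hs => by simp only [Real.norm_of_nonneg hs.le])
  rw [hnorm, lintegral_norm_rpow_neg (hμ.ae_pos.mono fun s hs => hs.ne') hr,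
    setLIntegral_congr_fun measurableSet_Ioi fun l hl => by rw [hμ.radialLaplace_eq l hl],
    ← ofReal_integral_eq_lintegral_ofReal (integrableOn_rpow_mul_exp_neg_rpow (by linarith) ha)
      (ae_restrict_of_forall_mem measurableSet_Ioi fun l (hl : 0 < l) => by positivity),
    ← ENNReal.ofReal_mul (inv_nonneg.2 hΓ.le), integral_rpow_mul_exp_neg_rpow ha (by linarith),
    add_comm 1 (r / a), add_comm 1 r, Real.Gamma_add_one (by positivity),
    Real.Gamma_add_one hr.ne', sub_add_cancel]
  congr 1
  field_simp

theorem integrable_rpow_neg (hμ : IsOneSidedStable a μ) (ha : 0 < a) {r : ℝ} (hr : 0 ≤ r) :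
    Integrable (fun s => s ^ (-r)) μ :=
  (lintegral_ofReal_ne_top_iff_integrable (by fun_prop)
    (hμ.ae_pos.mono fun s hs => by positivity)).1
    (hμ.lintegral_rpow_neg ha hr ▸ ENNReal.ofReal_ne_top)

theorem integral_rpow_neg (hμ : IsOneSidedStable a μ) (ha : 0 < a) {r : ℝ} (hr : 0 ≤ r) :
    ∫ s, s ^ (-r) ∂μ = Real.Gamma (1 + r / a) / Real.Gamma (1 + r) := by
  have := Real.Gamma_pos_of_pos (s := 1 + r / a) (by positivity)
  have := Real.Gamma_pos_of_pos (s := 1 + r) (by positivity)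
  rw [integral_eq_lintegral_of_nonneg_ae (hμ.ae_pos.mono fun s hs => by positivity) (by fun_prop),
    hμ.lintegral_rpow_neg ha hr, ENNReal.toReal_ofReal (by positivity)]

theorem lintegral_rpow_lt_top (hμ : IsOneSidedStable a μ) {q : ℝ} (hq : 0 ≤ q) (hqa : q < a) :
    ∫⁻ s, ENNReal.ofReal (s ^ q) ∂μ < ∞ := by
  rcases hq.eq_or_lt with rfl | hq
  · simp
  refine (lintegral_mono_ae (hμ.ae_pos.mono fun s hs => by rw [Real.norm_of_nonneg hs.le])).trans_lt
    (lintegral_norm_rpow_lt_top_of_one_sub_radialLaplace_le (a := a) hq hqa fun l hl => ?_)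
  rw [hμ.radialLaplace_eq l hl]
  linarith [Real.add_one_le_exp (-(l ^ a))]

end IsOneSidedStable

/-! ### Gaussian smoothing -/

theorem apply_add_smul_le {E : Type*} [SeminormedAddCommGroup E] [NormedSpace ℝ E] {V : E → ℝ}
    {p t : ℝ} (ht : 0 ≤ t) (hVadd : ∀ u y, V (u + y) ≤ V u + ‖y‖ ^ p) (u z : E) :
    V (u + t • z) ≤ V u + t ^ p * ‖z‖ ^ p :=
  (hVadd u (t • z)).trans_eq <| by
    rw [norm_smul, Real.norm_of_nonneg ht, Real.mul_rpow ht (norm_nonneg z)]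

theorem integrable_comp_add_smul_of_abs_le {E : Type*} [NormedAddCommGroup E] [NormedSpace ℝ E]
    [MeasurableSpace E] [BorelSpace E] {V g : E → ℝ} {p t : ℝ} (ht : 0 ≤ t)
    (hVadd : ∀ u y, V (u + y) ≤ V u + ‖y‖ ^ p) (hg : Measurable g) (hgV : ∀ y, |g y| ≤ V y)
    {μ : Measure E} [IsFiniteMeasure μ] (hμ : Integrable (fun z => ‖z‖ ^ p) μ) (c : E) :
    Integrable (fun z => g (c + t • z)) μ :=
  .mono' ((integrable_const (V c)).add (hμ.const_mul (t ^ p)))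
    (Measurable.aestronglyMeasurable (by fun_prop))
    (.of_forall fun z => (hgV _).trans (apply_add_smul_le ht hVadd c z))

section Gaussian

open Module (finrank)

variable {E : Type*} [NormedAddCommGroup E] [InnerProductSpace ℝ E]

/-- The density of the standard Gaussian law on a Euclidean space `E`. -/
def gaussianDensity (z : E) : ℝ :=
  (2 * Real.pi) ^ (-(finrank ℝ E : ℝ) / 2) * Real.exp (-(1 / 2) * ‖z‖ ^ 2)

theorem gaussianDensity_pos (z : E) : 0 < gaussianDensity z := by
  unfold gaussianDensity
  positivity

theorem continuous_gaussianDensity : Continuous (gaussianDensity : E → ℝ) := by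
  unfold gaussianDensity
  fun_prop

theorem hasDerivAt_gaussianDensity_sub_smul (h z : E) (r : ℝ) :
    HasDerivAt (fun r : ℝ => gaussianDensity (z - r • h))
      (inner ℝ h (z - r • h) * gaussianDensity (z - r • h)) r := by
  have hline : HasDerivAt (fun r : ℝ => z - r • h) (-h) r := by
    simpa using ((hasDerivAt_id r).smul_const h).const_sub z
  refine (((hline.norm_sq.const_mul (-(1 / 2) : ℝ)).exp).const_mul
    ((2 * Real.pi) ^ (-(finrank ℝ E : ℝ) / 2))).congr_deriv ?_
  rw [gaussianDensity, inner_neg_right, real_inner_comm]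
  ring

theorem gaussianDensity_sub_eq_integral (h z : E) :
    gaussianDensity (z - h) - gaussianDensity z
      = ∫ r in (0 : ℝ)..1, inner ℝ h (z - r • h) * gaussianDensity (z - r • h) := by
  have hc : Continuous fun r : ℝ => inner ℝ h (z - r • h) * gaussianDensity (z - r • h) := by
    have := continuous_gaussianDensity (E := E)
    fun_prop
  rw [intervalIntegral.integral_eq_sub_of_hasDerivAt
    (fun r _ => hasDerivAt_gaussianDensity_sub_smul h z r) (hc.intervalIntegrable _ _)]
  simp

theorem enorm_gaussianDensity_sub_le (h z : E) :
    ‖gaussianDensity (z - h) - gaussianDensity z‖ₑ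
      ≤ ∫⁻ r in Ioc (0 : ℝ) 1, ‖inner ℝ h (z - r • h)‖ₑ
          * ENNReal.ofReal (gaussianDensity (z - r • h)) := by
  rw [gaussianDensity_sub_eq_integral, intervalIntegral.integral_of_le zero_le_one]
  refine (enorm_integral_le_lintegral_enorm _).trans_eq (lintegral_congr fun r => ?_)
  rw [enorm_mul, Real.enorm_of_nonneg (gaussianDensity_pos _).le]

variable [FiniteDimensional ℝ E] [MeasurableSpace E] [BorelSpace E]

theorem integrable_gaussianDensity : Integrable (gaussianDensity : E → ℝ) := by
  refine .const_mul (.of_integral_ne_zero ?_) _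
  rw [GaussianFourier.integral_rexp_neg_mul_sq_norm (by norm_num)]
  positivity

theorem stdGaussian_eq_withDensity :
    stdGaussian E = volume.withDensity (fun z => ENNReal.ofReal (gaussianDensity z)) := by
  have : IsFiniteMeasure ((volume : Measure E).withDensity
      (fun z => ENNReal.ofReal (gaussianDensity z))) :=
    isFiniteMeasure_withDensity_ofReal integrable_gaussianDensity.2
  refine Measure.ext_of_charFun (funext fun t => ?_)
  have hintegrand : ∀ x : E,
      (ENNReal.ofReal (gaussianDensity x)).toReal • Complex.exp (inner ℝ x t * Complex.I)
      = (((2 * Real.pi) ^ (-(finrank ℝ E : ℝ) / 2) : ℝ) : ℂ)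
        * Complex.exp (-(1 / 2 : ℂ) * ‖x‖ ^ 2 + Complex.I * inner ℝ t x) := fun x => by
    rw [ENNReal.toReal_ofReal (gaussianDensity_pos x).le, gaussianDensity, Complex.real_smul,
      Complex.ofReal_mul, mul_assoc, Complex.ofReal_exp, ← Complex.exp_add, real_inner_comm]
    push_cast
    ring_nf
  have hnormalization : ((Real.pi : ℂ) / (1 / 2)) ^ ((finrank ℝ E : ℂ) / 2)
      = (((2 * Real.pi) ^ ((finrank ℝ E : ℝ) / 2) : ℝ) : ℂ) := by
    rw [Complex.ofReal_cpow (by positivity)]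
    simp [mul_comm]
  rw [charFun_stdGaussian, charFun_apply, integral_withDensity_eq_integral_toReal_smul
    continuous_gaussianDensity.measurable.ennreal_ofReal
    (.of_forall fun x => ENNReal.ofReal_lt_top)]
  simp_rw [hintegrand]
  rw [integral_const_mul, GaussianFourier.integral_cexp_neg_mul_sq_norm_add (by norm_num),
    hnormalization, ← mul_assoc, ← Complex.ofReal_mul, ← Real.rpow_add (by positivity),
    neg_div (2 : ℝ), neg_add_cancel, Real.rpow_zero, Complex.ofReal_one, one_mul, Complex.I_sq]
  congr 1
  ring

theorem lintegral_stdGaussian {g : E → ℝ≥0∞} (hg : Measurable g) :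
    ∫⁻ z, g z ∂(stdGaussian E) = ∫⁻ z, ENNReal.ofReal (gaussianDensity z) * g z := by
  rw [stdGaussian_eq_withDensity, lintegral_withDensity_eq_lintegral_mul _
    continuous_gaussianDensity.measurable.ennreal_ofReal hg]
  rfl

theorem integral_stdGaussian (g : E → ℝ) :
    ∫ z, g z ∂(stdGaussian E) = ∫ z, gaussianDensity z * g z := by
  rw [stdGaussian_eq_withDensity, integral_withDensity_eq_integral_toReal_smul
    continuous_gaussianDensity.measurable.ennreal_ofReal
    (.of_forall fun x => ENNReal.ofReal_lt_top)]
  simp_rw [ENNReal.toReal_ofReal (gaussianDensity_pos _).le, smul_eq_mul]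

theorem integrable_stdGaussian_iff (g : E → ℝ) :
    Integrable g (stdGaussian E) ↔ Integrable (fun z => gaussianDensity z * g z) := by
  rw [stdGaussian_eq_withDensity, integrable_withDensity_iff_integrable_smul'
    continuous_gaussianDensity.measurable.ennreal_ofReal
    (.of_forall fun x => ENNReal.ofReal_lt_top)]
  simp_rw [ENNReal.toReal_ofReal (gaussianDensity_pos _).le, smul_eq_mul]

theorem lintegral_enorm_inner_sq_stdGaussian (h : E) :
    ∫⁻ z, ‖(inner ℝ h z : ℝ)‖ₑ ^ (2 : ℝ) ∂(stdGaussian E) = ENNReal.ofReal (‖h‖ ^ 2) := by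
  have hvar := variance_dual_stdGaussian (innerSL ℝ h)
  rw [innerSL_apply_norm, variance_of_integral_eq_zero (by fun_prop)
    (integral_strongDual_stdGaussian _)] at hvar
  have hmemLp : MemLp (innerSL ℝ h) 2 (stdGaussian E) := IsGaussian.memLp_dual _ _ _ (by simp)
  rw [← hvar, ofReal_integral_eq_lintegral_ofReal hmemLp.integrable_sq
    (.of_forall fun z => sq_nonneg _)]
  refine lintegral_congr fun z => ?_
  rw [Real.enorm_eq_ofReal_abs, ENNReal.ofReal_rpow_of_nonneg (abs_nonneg _) zero_le_two]
  simp

theorem lintegral_mul_enorm_inner_stdGaussian_le {f : E → ℝ≥0∞} (hf : Measurable f) (h : E) :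
    ∫⁻ z, f z * ‖(inner ℝ h z : ℝ)‖ₑ ∂(stdGaussian E)
      ≤ (∫⁻ z, f z ^ (2 : ℝ) ∂(stdGaussian E)) ^ (1 / 2 : ℝ) * ENNReal.ofReal ‖h‖ := by
  refine (ENNReal.lintegral_mul_le_Lp_mul_Lq _ Real.HolderConjugate.two_two hf.aemeasurable
    (by fun_prop)).trans_eq ?_
  rw [lintegral_enorm_inner_sq_stdGaussian,
    ENNReal.ofReal_rpow_of_nonneg (by positivity) (by norm_num), ← Real.sqrt_eq_rpow,
    Real.sqrt_sq (norm_nonneg _)]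

/-- The moment `E ‖Z‖ ^ q` of a standard Gaussian vector `Z` in dimension `n`. At `n = 0` the value
of `Γ 0` is junk, so the formula is used for `n > 0` only. -/
def gaussianNormMoment (n : ℕ) (q : ℝ) : ℝ :=
  2 ^ (q / 2) * (Real.Gamma ((q + n) / 2) / Real.Gamma (n / 2))

theorem gaussianNormMoment_pos {n : ℕ} (hn : 0 < n) {q : ℝ} (hq : -(n : ℝ) < q) :
    0 < gaussianNormMoment n q := by
  have := Real.Gamma_pos_of_pos (show 0 < (n : ℝ) / 2 by positivity)
  have := Real.Gamma_pos_of_pos (show 0 < (q + n) / 2 by linarith)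
  unfold gaussianNormMoment
  positivity

theorem integral_gaussianDensity_mul_norm_rpow [Nontrivial E] {q : ℝ}
    (hq : -(finrank ℝ E : ℝ) < q) :
    ∫ z : E, gaussianDensity z * ‖z‖ ^ q = gaussianNormMoment (finrank ℝ E) q := by
  have hn : 0 < finrank ℝ E := Module.finrank_pos
  have hn' : (0 : ℝ) < finrank ℝ E := by exact_mod_cast hn
  have := Real.Gamma_pos_of_pos (half_pos hn')
  have hradial : ∫ y in Ioi (0 : ℝ), y ^ (finrank ℝ E - 1) •
        ((2 * Real.pi) ^ (-(finrank ℝ E : ℝ) / 2) * Real.exp (-(1 / 2) * y ^ 2) * y ^ q)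
      = (2 * Real.pi) ^ (-(finrank ℝ E : ℝ) / 2) *
        ((1 / 2) ^ (-((finrank ℝ E : ℝ) + q) / 2) * (1 / 2) *
          Real.Gamma ((finrank ℝ E + q) / 2)) := by
    have hgamma := integral_rpow_mul_exp_neg_mul_rpow (p := 2) (q := finrank ℝ E - 1 + q)
      (b := 1 / 2) two_pos (by linarith) (by norm_num)
    rw [sub_add_eq_add_sub, sub_add_cancel] at hgamma
    rw [← hgamma, ← integral_const_mul]
    refine setIntegral_congr_fun measurableSet_Ioi fun y (hy : 0 < y) => ?_
    simp only [smul_eq_mul]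
    rw [Real.rpow_sub_one hy.ne', Real.rpow_add hy, Real.rpow_two, Real.rpow_natCast,
      ← pow_sub_one_mul hn.ne']
    field_simp
  refine (integral_fun_norm_addHaar volume fun y => (2 * Real.pi) ^
    (-(finrank ℝ E : ℝ) / 2) * Real.exp (-(1 / 2) * y ^ 2) * y ^ q).trans ?_
  rw [hradial, Measure.real,
    InnerProductSpace.volume_ball, ENNReal.ofReal_one, one_pow, one_mul,
    ENNReal.toReal_ofReal (by positivity), Real.Gamma_add_one (by positivity), nsmul_eq_mul,
    smul_eq_mul, Real.mul_rpow zero_le_two Real.pi_pos.le, Real.sqrt_eq_rpow, ← Real.rpow_natCast,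
    ← Real.rpow_mul Real.pi_pos.le, one_div, Real.inv_rpow zero_le_two, gaussianNormMoment,
    add_comm q, neg_div, neg_div, Real.rpow_neg zero_le_two, Real.rpow_neg zero_le_two,
    Real.rpow_neg Real.pi_pos.le, add_div, Real.rpow_add two_pos, inv_mul_eq_div 2]
  field_simp

theorem integrable_gaussianDensity_mul_norm_rpow [Nontrivial E] {q : ℝ}
    (hq : -(finrank ℝ E : ℝ) < q) : Integrable fun z : E => gaussianDensity z * ‖z‖ ^ q :=
  .of_integral_ne_zero <| by
    rw [integral_gaussianDensity_mul_norm_rpow hq]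
    exact (gaussianNormMoment_pos Module.finrank_pos hq).ne'

theorem integrable_norm_rpow_stdGaussian [Nontrivial E] {q : ℝ} (hq : -(finrank ℝ E : ℝ) < q) :
    Integrable (fun z => ‖z‖ ^ q) (stdGaussian E) :=
  (integrable_stdGaussian_iff _).2 (integrable_gaussianDensity_mul_norm_rpow hq)

theorem integral_norm_rpow_stdGaussian [Nontrivial E] {q : ℝ} (hq : -(finrank ℝ E : ℝ) < q) :
    ∫ z, ‖z‖ ^ q ∂(stdGaussian E) = gaussianNormMoment (finrank ℝ E) q :=
  (integral_stdGaussian _).trans (integral_gaussianDensity_mul_norm_rpow hq)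

theorem lintegral_norm_rpow_mul_enorm_inner_stdGaussian_le [Nontrivial E] {p : ℝ}
    (hp : -(finrank ℝ E : ℝ) < 2 * p) (h : E) :
    ∫⁻ z, ENNReal.ofReal (‖z‖ ^ p) * ‖(inner ℝ h z : ℝ)‖ₑ ∂(stdGaussian E)
      ≤ ENNReal.ofReal (√(gaussianNormMoment (finrank ℝ E) (2 * p)) * ‖h‖) := by
  refine (lintegral_mul_enorm_inner_stdGaussian_le (by fun_prop) h).trans_eq ?_
  have hsq : ∀ z : E, ENNReal.ofReal (‖z‖ ^ p) ^ (2 : ℝ) = ENNReal.ofReal (‖z‖ ^ (2 * p)) :=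
    fun z => by
      rw [ENNReal.ofReal_rpow_of_nonneg (by positivity) zero_le_two,
        ← Real.rpow_mul (by positivity), mul_comm p]
  simp_rw [hsq]
  rw [← ofReal_integral_eq_lintegral_ofReal (integrable_norm_rpow_stdGaussian hp)
      (.of_forall fun z => by positivity), integral_norm_rpow_stdGaussian hp,
    ENNReal.ofReal_rpow_of_nonneg (gaussianNormMoment_pos Module.finrank_pos hp).le (by norm_num),
    ← Real.sqrt_eq_rpow, ENNReal.ofReal_mul (Real.sqrt_nonneg _)]

theorem lintegral_weight_mul_enorm_inner_stdGaussian_le [Nontrivial E] {p A T : ℝ}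
    (hp : -(finrank ℝ E : ℝ) < 2 * p) (hA : 0 ≤ A) (hT : 0 ≤ T) (h : E) :
    ∫⁻ z, ENNReal.ofReal (A + T * ‖z‖ ^ p) * ‖(inner ℝ h z : ℝ)‖ₑ ∂(stdGaussian E)
      ≤ ENNReal.ofReal (‖h‖ * (A + T * √(gaussianNormMoment (finrank ℝ E) (2 * p)))) := by
  have hconst : ∫⁻ z, ‖(inner ℝ h z : ℝ)‖ₑ ∂(stdGaussian E) ≤ ENNReal.ofReal ‖h‖ := by
    simpa using lintegral_mul_enorm_inner_stdGaussian_le (f := fun _ => 1) measurable_const h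
  calc ∫⁻ z, ENNReal.ofReal (A + T * ‖z‖ ^ p) * ‖(inner ℝ h z : ℝ)‖ₑ ∂(stdGaussian E)
      = ENNReal.ofReal A * ∫⁻ z, ‖(inner ℝ h z : ℝ)‖ₑ ∂(stdGaussian E) + ENNReal.ofReal T *
          ∫⁻ z, ENNReal.ofReal (‖z‖ ^ p) * ‖(inner ℝ h z : ℝ)‖ₑ ∂(stdGaussian E) := by
        rw [← lintegral_const_mul _ (by fun_prop), ← lintegral_const_mul _ (by fun_prop),
          ← lintegral_add_left (by fun_prop)]
        refine lintegral_congr fun z => ?_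
        rw [ENNReal.ofReal_add hA (by positivity), ENNReal.ofReal_mul hT]
        ring
    _ ≤ ENNReal.ofReal A * ENNReal.ofReal ‖h‖ + ENNReal.ofReal T *
          ENNReal.ofReal (√(gaussianNormMoment (finrank ℝ E) (2 * p)) * ‖h‖) := by
        gcongr
        exact lintegral_norm_rpow_mul_enorm_inner_stdGaussian_le hp h
    _ = ENNReal.ofReal (‖h‖ * (A + T * √(gaussianNormMoment (finrank ℝ E) (2 * p)))) := by
        rw [← ENNReal.ofReal_mul hA, ← ENNReal.ofReal_mul hT,
          ← ENNReal.ofReal_add (by positivity) (by positivity)]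
        congr 1
        ring

theorem enorm_integral_shift_stdGaussian_le {G : E → ℝ} {W : E → ℝ≥0∞} (hW : Measurable W)
    (hGW : ∀ z, ‖G z‖ₑ ≤ W z) (h : E) (hG : Integrable G (stdGaussian E))
    (hGh : Integrable (fun z => G (z + h)) (stdGaussian E)) :
    ‖∫ z, G (z + h) ∂(stdGaussian E) - ∫ z, G z ∂(stdGaussian E)‖ₑ
      ≤ ∫⁻ r in Ioc (0 : ℝ) 1, ∫⁻ z, W (z + r • h) * ‖(inner ℝ h z : ℝ)‖ₑ ∂(stdGaussian E) := by
  have hmeas := (continuous_gaussianDensity (E := E)).measurable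
  have hshift : ∫ z, gaussianDensity z * G (z + h) = ∫ z, gaussianDensity (z - h) * G z := by
    rw [← integral_add_right_eq_self (fun z => gaussianDensity (z - h) * G z) h]
    simp
  rw [integrable_stdGaussian_iff] at hG hGh
  have hGh' : Integrable (fun z => gaussianDensity (z - h) * G z) := by
    simpa using hGh.comp_sub_right h
  rw [integral_stdGaussian, integral_stdGaussian, hshift, ← integral_sub hGh' hG]
  calc ‖∫ z, (gaussianDensity (z - h) * G z - gaussianDensity z * G z)‖ₑ
      ≤ ∫⁻ z, ‖gaussianDensity (z - h) * G z - gaussianDensity z * G z‖ₑ :=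
        enorm_integral_le_lintegral_enorm _
    _ ≤ ∫⁻ z, ∫⁻ r in Ioc (0 : ℝ) 1, W z * (‖(inner ℝ h (z - r • h) : ℝ)‖ₑ
          * ENNReal.ofReal (gaussianDensity (z - r • h))) := by
        refine lintegral_mono fun z => ?_
        rw [lintegral_const_mul _ (by fun_prop), ← sub_mul, enorm_mul, mul_comm]
        exact mul_le_mul' (hGW z) (enorm_gaussianDensity_sub_le h z)
    _ = ∫⁻ r in Ioc (0 : ℝ) 1, ∫⁻ z, W z * (‖(inner ℝ h (z - r • h) : ℝ)‖ₑ
          * ENNReal.ofReal (gaussianDensity (z - r • h))) :=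
        lintegral_lintegral_swap (by fun_prop)
    _ = _ := by
        refine lintegral_congr fun r => ?_
        rw [lintegral_stdGaussian (by fun_prop), ← lintegral_add_right_eq_self _ (r • h)]
        refine lintegral_congr fun z => ?_
        rw [add_sub_cancel_right]
        ring

theorem norm_integral_shift_stdGaussian_le [Nontrivial E] {V g : E → ℝ} {p t A : ℝ}
    (hp : -(finrank ℝ E : ℝ) < 2 * p) (ht : 0 < t) (hV : Measurable V)
    (hVadd : ∀ u y, V (u + y) ≤ V u + ‖y‖ ^ p) (hg : Measurable g) (hgV : ∀ y, |g y| ≤ V y)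
    {a b : E} (hA : ∀ u ∈ segment ℝ a b, V u ≤ A) :
    ‖∫ z, g (b + t • z) ∂(stdGaussian E) - ∫ z, g (a + t • z) ∂(stdGaussian E)‖
      ≤ ‖b - a‖ / t * (A + t ^ p * √(gaussianNormMoment (finrank ℝ E) (2 * p))) := by
  have hA0 : 0 ≤ A := (abs_nonneg _).trans ((hgV a).trans (hA a (left_mem_segment ℝ a b)))
  have hint := integrable_comp_add_smul_of_abs_le (μ := stdGaussian E) ht.le hVadd hg hgV
    (integrable_norm_rpow_stdGaussian (by linarith [(finrank ℝ E).cast_nonneg (α := ℝ)]))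
  obtain ⟨h, hth⟩ : ∃ h : E, t • h = b - a := ⟨t⁻¹ • (b - a), smul_inv_smul₀ ht.ne' _⟩
  have hnorm : ‖h‖ = ‖b - a‖ / t := by
    rw [← hth, norm_smul, Real.norm_of_nonneg ht.le, mul_div_cancel_left₀ _ ht.ne']
  have hb : ∀ z, b + t • z = a + t • (z + h) := fun z => by
    rw [smul_add, hth]
    abel
  have hint_b := hint b
  simp_rw [hb] at hint_b ⊢
  have hweight : ∀ r ∈ Ioc (0 : ℝ) 1, ∀ z, V (a + t • (z + r • h)) ≤ A + t ^ p * ‖z‖ ^ p :=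
    fun r hr z => by
      have hmem : a + r • (b - a) ∈ segment ℝ a b := by
        rw [segment_eq_image']
        exact ⟨r, ⟨hr.1.le, hr.2⟩, rfl⟩
      rw [smul_add, smul_comm t r h, hth, add_comm (t • z), ← add_assoc]
      exact (apply_add_smul_le ht.le hVadd _ z).trans (by gcongr; exact hA _ hmem)
  refine (ENNReal.ofReal_le_ofReal_iff (by positivity)).1 ?_
  rw [ofReal_norm, ← hnorm]
  calc _ ≤ ∫⁻ r in Ioc (0 : ℝ) 1, ∫⁻ z, ENNReal.ofReal (V (a + t • (z + r • h)))
          * ‖(inner ℝ h z : ℝ)‖ₑ ∂(stdGaussian E) :=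
        enorm_integral_shift_stdGaussian_le (G := fun z => g (a + t • z))
          (W := fun z => ENNReal.ofReal (V (a + t • z))) (by fun_prop)
          (fun z => (Real.enorm_eq_ofReal_abs _).trans_le (ENNReal.ofReal_le_ofReal (hgV _))) h
          (hint a) hint_b
    _ ≤ ∫⁻ _ in Ioc (0 : ℝ) 1, ENNReal.ofReal (‖h‖ *
          (A + t ^ p * √(gaussianNormMoment (finrank ℝ E) (2 * p)))) :=
        setLIntegral_mono measurable_const fun r hr =>
          (lintegral_mono fun z => mul_le_mul_left (ENNReal.ofReal_le_ofReal (hweight r hr z))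
            _).trans (lintegral_weight_mul_enorm_inner_stdGaussian_le hp hA0 (by positivity) h)
    _ = _ := by simp

end Gaussian

/-! ### Gaussian mixtures and subordination -/

section GaussianMixture

open Module (finrank)

variable {E : Type*} [NormedAddCommGroup E] [InnerProductSpace ℝ E] [FiniteDimensional ℝ E]
  [MeasurableSpace E] [BorelSpace E]

variable (E) in
/-- The law of `√(2S) Z`, where `S` has law `μ` and `Z` is an independent standard Gaussian vector
of `E`: the Brownian motion of generator `Δ` at the random time `S`. -/
def gaussianMixture (μ : Measure ℝ) : Measure E :=
  (μ.prod (stdGaussian E)).map fun q => √(2 * q.1) • q.2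

variable {μ : Measure ℝ}

theorem integrable_norm_rpow_gaussianMixture [Nontrivial E] [SFinite μ] {p : ℝ}
    (hp : -(finrank ℝ E : ℝ) < p) (hμ : Integrable (fun s => √(2 * s) ^ p) μ) :
    Integrable (fun y => ‖y‖ ^ p) (gaussianMixture E μ) := by
  rw [gaussianMixture, integrable_map_measure (Measurable.aestronglyMeasurable (by fun_prop))
    (by fun_prop)]
  refine (hμ.mul_prod (integrable_norm_rpow_stdGaussian hp)).congr (.of_forall fun q => ?_)
  simp [norm_smul, Real.mul_rpow, abs_of_nonneg]

variable [IsProbabilityMeasure μ]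

instance isProbabilityMeasure_gaussianMixture : IsProbabilityMeasure (gaussianMixture E μ) :=
  Measure.isProbabilityMeasure_map (by fun_prop)

theorem charFun_stdGaussian_smul_sqrt {s : ℝ} (hs : 0 ≤ s) (t : E) :
    ∫ z, Complex.exp (inner ℝ (√(2 * s) • z) t * Complex.I) ∂(stdGaussian E)
      = ((Real.exp (-(‖t‖ ^ 2 * s)) : ℝ) : ℂ) := by
  have hcharFun := charFun_stdGaussian (√(2 * s) • t)
  simp_rw [charFun_apply, real_inner_smul_right] at hcharFun
  simp_rw [real_inner_smul_left, hcharFun, norm_smul, Real.norm_of_nonneg (Real.sqrt_nonneg _)]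
  rw [← Complex.ofReal_pow, mul_pow, Real.sq_sqrt (by positivity)]
  push_cast
  ring_nf

theorem charFun_gaussianMixture (hμ : ∀ᵐ s ∂μ, 0 ≤ s) (t : E) :
    charFun (gaussianMixture E μ) t = ((∫ s, Real.exp (-(‖t‖ ^ 2 * s)) ∂μ : ℝ) : ℂ) := by
  have hint : Integrable (fun q : ℝ × E => Complex.exp (inner ℝ (√(2 * q.1) • q.2) t * Complex.I))
      (μ.prod (stdGaussian E)) :=
    .of_bound (by fun_prop) 1 (.of_forall fun q => (Complex.norm_exp_ofReal_mul_I _).le)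
  rw [charFun_apply, gaussianMixture, integral_map (by fun_prop) (by fun_prop),
    integral_prod _ hint, ← integral_complex_ofReal]
  exact integral_congr_ae (hμ.mono fun s hs => charFun_stdGaussian_smul_sqrt hs t)

theorem integral_gaussianMixture {g : E → ℝ} (hg : Measurable g)
    (hint : Integrable g (gaussianMixture E μ)) :
    ∫ y, g y ∂(gaussianMixture E μ) = ∫ s, ∫ z, g (√(2 * s) • z) ∂(stdGaussian E) ∂μ := by
  rw [gaussianMixture, integrable_map_measure (by fun_prop) (by fun_prop)] at hint
  rw [gaussianMixture, integral_map (by fun_prop) (by fun_prop)]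
  exact integral_prod _ hint

theorem norm_integral_shift_gaussianMixture_le [Nontrivial E] {V g : E → ℝ} {p σ A : ℝ}
    (hp : -(finrank ℝ E : ℝ) < 2 * p) (hσ : 0 < σ) (hV : Measurable V)
    (hVadd : ∀ u y, V (u + y) ≤ V u + ‖y‖ ^ p) (hg : Measurable g) (hgV : ∀ y, |g y| ≤ V y)
    {a b : E} (hA : ∀ u ∈ segment ℝ a b, V u ≤ A) (hμ : ∀ᵐ s ∂μ, 0 < s)
    (hμp : Integrable (fun s => √(2 * s) ^ p) μ) (hμ₁ : Integrable (fun s => s ^ (-(1 / 2) : ℝ)) μ)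
    (hμ₂ : Integrable (fun s => s ^ (-((1 - p) / 2))) μ) :
    ‖∫ y, g (b + σ • y) ∂(gaussianMixture E μ) - ∫ y, g (a + σ • y) ∂(gaussianMixture E μ)‖
      ≤ ‖b - a‖ / (σ * √2) * (A * ∫ s, s ^ (-(1 / 2) : ℝ) ∂μ + (σ * √2) ^ p *
          √(gaussianNormMoment (finrank ℝ E) (2 * p)) * ∫ s, s ^ (-((1 - p) / 2)) ∂μ) := by
  have hint := integrable_comp_add_smul_of_abs_le hσ.le hVadd hg hgV
    (integrable_norm_rpow_gaussianMixture (E := E)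
      (by linarith [(finrank ℝ E).cast_nonneg (α := ℝ)]) hμp)
  have hprod : ∀ c, Integrable (fun s => ∫ z, g (c + σ • √(2 * s) • z) ∂(stdGaussian E)) μ :=
    fun c => ((integrable_map_measure (Measurable.aestronglyMeasurable (by fun_prop))
      (by fun_prop)).1 (hint c)).integral_prod_left
  rw [integral_gaussianMixture (by fun_prop) (hint a), integral_gaussianMixture (by fun_prop)
    (hint b), ← integral_sub (hprod b) (hprod a), ← integral_const_mul, ← integral_const_mul,
    ← integral_add (hμ₁.const_mul _) (hμ₂.const_mul _), ← integral_const_mul]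
  refine norm_integral_le_of_norm_le (((hμ₁.const_mul _).add (hμ₂.const_mul _)).const_mul _)
    (hμ.mono fun s hs => ?_)
  simp_rw [smul_smul]
  refine (norm_integral_shift_stdGaussian_le hp (by positivity) hV hVadd hg hgV hA).trans_eq ?_
  have hhalf : s ^ (-(1 / 2) : ℝ) = (√s)⁻¹ := by rw [Real.rpow_neg hs.le, Real.sqrt_eq_rpow]
  have hp_half : s ^ (-((1 - p) / 2)) = √s ^ p * (√s)⁻¹ := by
    rw [← hhalf, Real.sqrt_eq_rpow, ← Real.rpow_mul hs.le, ← Real.rpow_add hs]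
    ring_nf
  rw [hhalf, hp_half, Real.sqrt_mul zero_le_two, ← mul_assoc, Real.mul_rpow (by positivity)
    (Real.sqrt_nonneg s)]
  field_simp

end GaussianMixture

/-! ### Rotationally invariant stable laws -/

theorem gamma_div_gamma_three_halves (α : ℝ) :
    Real.Gamma (1 + 1 / 2 / (α / 2)) / Real.Gamma (1 + 1 / 2)
      = 2 / √Real.pi * Real.Gamma (1 + 1 / α) := by
  rw [div_div_div_cancel_right₀ two_ne_zero, add_comm 1 (1 / 2), Real.Gamma_add_one (by norm_num),
    Real.Gamma_one_half_eq]
  field_simp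

theorem IsOneSidedStable.integrable_sqrt_two_mul_rpow {a : ℝ} {μ : Measure ℝ}
    [IsProbabilityMeasure μ] (hμ : IsOneSidedStable a μ) {p : ℝ} (hp : 0 ≤ p) (hpa : p < 2 * a) :
    Integrable (fun s => √(2 * s) ^ p) μ := by
  have hint : Integrable (fun s => s ^ (p / 2)) μ :=
    (lintegral_ofReal_ne_top_iff_integrable (by fun_prop)
      (hμ.ae_pos.mono fun s hs => by positivity)).1
      (hμ.lintegral_rpow_lt_top (by positivity) (by linarith)).ne
  refine (hint.const_mul (2 ^ (p / 2))).congr (hμ.ae_pos.mono fun s hs => ?_)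
  simp only
  rw [Real.sqrt_eq_rpow, ← Real.rpow_mul (by positivity), one_div_mul_eq_div,
    Real.mul_rpow zero_le_two hs.le]

/-- The factor in the bound `‖b - a‖ / σ * stableShiftWeight d α p σ A` for the change of the
integral of `g` when a rotationally invariant `α`-stable law on `ℝ^d`, scaled by `σ`, is moved from
`a` to `b`. Here `|g| ≤ V` for a weight `V` that is at most `A` on the segment from `a` to `b` and
satisfies `V (u + y) ≤ V u + ‖y‖ ^ p`. -/
def stableShiftWeight (d : ℕ) (α p σ A : ℝ) : ℝ :=
  A * (2 / √Real.pi * Real.Gamma (1 + 1 / α)) +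
    σ ^ p * √(gaussianNormMoment d (2 * p)) *
      (Real.Gamma ((1 + α - p) / α) / Real.Gamma ((3 - p) / 2))

section StableShiftWeight

variable {d : ℕ} {α p σ A : ℝ}

theorem stableShiftWeight_pos (hα : 0 < α) (hp : p ≤ 1) (hσ : 0 < σ) (hA : 0 < A) :
    0 < stableShiftWeight d α p σ A := by
  have := Real.Gamma_pos_of_pos (show 0 < 1 + 1 / α by positivity)
  have := Real.Gamma_pos_of_pos (show 0 < (1 + α - p) / α from div_pos (by linarith) hα)
  have := Real.Gamma_pos_of_pos (show 0 < (3 - p) / 2 by linarith)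
  unfold stableShiftWeight
  positivity

theorem stableShiftWeight_mono (hα : 0 < α) : Monotone (stableShiftWeight d α p σ) := by
  intro A A' hAA'
  have := Real.Gamma_pos_of_pos (show 0 < 1 + 1 / α by positivity)
  unfold stableShiftWeight
  gcongr

theorem stableShiftWeight_mul_le (hα : 0 < α) (hp : p ≤ 1) (hσ : 0 < σ) {v : ℝ} (hv : 1 ≤ v) :
    stableShiftWeight d α p σ (A * v) ≤ stableShiftWeight d α p σ A * v := by
  have := Real.Gamma_pos_of_pos (show 0 < (1 + α - p) / α from div_pos (by linarith) hα)
  have := Real.Gamma_pos_of_pos (show 0 < (3 - p) / 2 by linarith)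
  rw [stableShiftWeight, stableShiftWeight, add_mul, mul_right_comm]
  exact add_le_add_right (le_mul_of_one_le_right (by positivity) hv) _

end StableShiftWeight

namespace IsRotInvStable

variable {d : ℕ} {α : ℝ} {ν : Measure (EuclideanSpace ℝ (Fin d))}

theorem eq_gaussianMixture [IsFiniteMeasure ν] (hν : IsRotInvStable α ν) (hα : 0 < α)
    {μ : Measure ℝ} [IsProbabilityMeasure μ] (hμ : IsOneSidedStable (α / 2) μ) :
    ν = gaussianMixture (EuclideanSpace ℝ (Fin d)) μ := by
  refine Measure.ext_of_charFun (funext fun t => ?_)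
  rw [hν t, charFun_gaussianMixture (hμ.ae_pos.mono fun s => le_of_lt)]
  rcases eq_or_ne t 0 with rfl | ht
  · simp [Real.zero_rpow hα.ne']
  have hlaplace : ∫ s, Real.exp (-(‖t‖ ^ 2 * s)) ∂μ = radialLaplace μ (‖t‖ ^ 2) :=
    integral_congr_ae (hμ.ae_pos.mono fun s hs => by simp only [Real.norm_of_nonneg hs.le])
  rw [hlaplace, hμ.radialLaplace_eq _ (by positivity), ← Real.rpow_natCast,
    ← Real.rpow_mul (norm_nonneg t), Nat.cast_two, mul_div_cancel₀ α two_ne_zero]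

variable [NeZero d] {p : ℝ}

theorem integrable_norm_rpow [IsFiniteMeasure ν] (hν : IsRotInvStable α ν) (hα : α ≤ 2)
    (hp : 0 ≤ p) (hpα : p < α) : Integrable (fun y => ‖y‖ ^ p) ν := by
  have hα0 : 0 < α := hp.trans_lt hpα
  have hd : (0 : ℝ) < d := Nat.cast_pos.2 (Nat.pos_of_neZero d)
  obtain ⟨μ, hμ⟩ := exists_isOneSidedStable (a := α / 2) (by linarith) (by linarith)
  rw [hν.eq_gaussianMixture hα0 hμ]
  refine integrable_norm_rpow_gaussianMixture ?_
    (hμ.integrable_sqrt_two_mul_rpow hp (by linarith))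
  rw [finrank_euclideanSpace_fin]
  linarith

theorem norm_integral_shift_le [IsFiniteMeasure ν] (hν : IsRotInvStable α ν) (hα : α ≤ 2)
    (hp : 0 ≤ p) (hp1 : p ≤ 1) (hpα : p < α) {σ A : ℝ} (hσ : 0 < σ)
    {V g : EuclideanSpace ℝ (Fin d) → ℝ} (hV : Measurable V)
    (hVadd : ∀ u y, V (u + y) ≤ V u + ‖y‖ ^ p) (hg : Measurable g) (hgV : ∀ y, |g y| ≤ V y)
    {a b : EuclideanSpace ℝ (Fin d)} (hA : ∀ u ∈ segment ℝ a b, V u ≤ A) :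
    ‖∫ y, g (b + σ • y) ∂ν - ∫ y, g (a + σ • y) ∂ν‖
      ≤ ‖b - a‖ / σ * stableShiftWeight d α p σ A := by
  have hα0 : 0 < α := hp.trans_lt hpα
  have hd : (0 : ℝ) < d := Nat.cast_pos.2 (Nat.pos_of_neZero d)
  obtain ⟨μ, hμ⟩ := exists_isOneSidedStable (a := α / 2) (by linarith) (by linarith)
  have := Real.Gamma_pos_of_pos (show 0 < 1 + 1 / α by positivity)
  have := Real.Gamma_pos_of_pos (show 0 < (1 + α - p) / α from div_pos (by linarith) hα0)
  have := Real.Gamma_pos_of_pos (show 0 < (3 - p) / 2 by linarith)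
  have hA0 : 0 ≤ A := (abs_nonneg _).trans ((hgV a).trans (hA a (left_mem_segment ℝ a b)))
  have hmixture := norm_integral_shift_gaussianMixture_le
    (by rw [finrank_euclideanSpace_fin]; linarith) hσ hV hVadd hg hgV hA hμ.ae_pos
    (hμ.integrable_sqrt_two_mul_rpow hp (by linarith))
    (hμ.integrable_rpow_neg (by linarith) (by norm_num))
    (hμ.integrable_rpow_neg (by linarith) (by linarith))
  rw [← hν.eq_gaussianMixture hα0 hμ, hμ.integral_rpow_neg (by linarith) (by norm_num),
    hμ.integral_rpow_neg (by linarith) (by linarith), gamma_div_gamma_three_halves,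
    finrank_euclideanSpace_fin, Real.mul_rpow hσ.le (Real.sqrt_nonneg 2),
    show 1 + (1 - p) / 2 / (α / 2) = (1 + α - p) / α by field_simp; ring,
    show 1 + (1 - p) / 2 = (3 - p) / 2 by ring] at hmixture
  have hsqrt : 1 ≤ √2 := Real.one_le_sqrt.2 one_le_two
  have hsqrt_rpow : √2 ^ p ≤ √2 := Real.rpow_le_self_of_one_le hsqrt hp1
  refine hmixture.trans ?_
  rw [stableShiftWeight, ← div_div, div_mul_eq_mul_div, mul_div_assoc, add_div]
  gcongr
  · exact div_le_self (by positivity) hsqrt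
  · rw [div_le_iff₀ (by positivity)]
    calc _ = σ ^ p * √(gaussianNormMoment d (2 * p)) *
            (Real.Gamma ((1 + α - p) / α) / Real.Gamma ((3 - p) / 2)) * √2 ^ p := by ring
      _ ≤ _ := by gcongr

end IsRotInvStable

/-! ### The Lyapunov function -/

section Lyapunov

variable {d : ℕ} {ϑ : EuclideanSpace ℝ (Fin d)} {p : ℝ}

theorem lyapunov_pos (θ : EuclideanSpace ℝ (Fin d)) : 0 < lyapunov ϑ p θ := by
  unfold lyapunov
  positivity

theorem one_le_lyapunov (hp : 0 ≤ p) (θ : EuclideanSpace ℝ (Fin d)) : 1 ≤ lyapunov ϑ p θ :=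
  Real.one_le_rpow (by simp) (by positivity)

theorem measurable_lyapunov : Measurable (lyapunov ϑ p) := by
  unfold lyapunov
  fun_prop

theorem lyapunov_eq_sqrt_rpow (θ : EuclideanSpace ℝ (Fin d)) :
    lyapunov ϑ p θ = √(1 + ‖θ - ϑ‖ ^ 2) ^ p := by
  rw [lyapunov, Real.sqrt_eq_rpow, ← Real.rpow_mul (by positivity), one_div_mul_eq_div]

theorem lyapunov_one_mul (θ : EuclideanSpace ℝ (Fin d)) :
    lyapunov ϑ 1 θ * lyapunov ϑ p θ = lyapunov ϑ (1 + p) θ := by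
  rw [lyapunov, lyapunov, lyapunov, ← Real.rpow_add (by positivity), add_div]

theorem sqrt_one_add_norm_sq_add_le {E : Type*} [SeminormedAddCommGroup E] (x y : E) :
    √(1 + ‖x + y‖ ^ 2) ≤ √(1 + ‖x‖ ^ 2) + ‖y‖ := by
  have hx : ‖x‖ ≤ √(1 + ‖x‖ ^ 2) := Real.le_sqrt_of_sq_le (by linarith)
  rw [Real.sqrt_le_left (by positivity)]
  calc 1 + ‖x + y‖ ^ 2 ≤ 1 + (‖x‖ + ‖y‖) ^ 2 := by gcongr; exact norm_add_le x y
    _ = √(1 + ‖x‖ ^ 2) ^ 2 + 2 * ‖x‖ * ‖y‖ + ‖y‖ ^ 2 := by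
      rw [Real.sq_sqrt (by positivity)]
      ring
    _ ≤ √(1 + ‖x‖ ^ 2) ^ 2 + 2 * √(1 + ‖x‖ ^ 2) * ‖y‖ + ‖y‖ ^ 2 := by gcongr
    _ = (√(1 + ‖x‖ ^ 2) + ‖y‖) ^ 2 := by ring

theorem lyapunov_add_le (hp : 0 ≤ p) (hp1 : p ≤ 1) (u y : EuclideanSpace ℝ (Fin d)) :
    lyapunov ϑ p (u + y) ≤ lyapunov ϑ p u + ‖y‖ ^ p := by
  rw [lyapunov_eq_sqrt_rpow, lyapunov_eq_sqrt_rpow, add_sub_right_comm]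
  exact (Real.rpow_le_rpow (Real.sqrt_nonneg _) (sqrt_one_add_norm_sq_add_le _ _) hp).trans
    (Real.rpow_add_le_add_rpow (Real.sqrt_nonneg _) (norm_nonneg _) hp hp1)

theorem lyapunov_le_mul_lyapunov (hp : 0 ≤ p) (hp2 : p ≤ 2) {ρ c : ℝ} (hρ : 0 ≤ ρ) (hc : 0 ≤ c)
    {u θ : EuclideanSpace ℝ (Fin d)} (hu : ‖u - ϑ‖ ^ 2 ≤ ρ * ‖θ - ϑ‖ ^ 2 + c) :
    lyapunov ϑ p u ≤ (1 + ρ ^ (p / 2) + c ^ (p / 2)) * lyapunov ϑ p θ := by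
  have hq : 0 ≤ p / 2 := by positivity
  have hq1 : p / 2 ≤ 1 := by linarith
  have hone := one_le_lyapunov (ϑ := ϑ) hp θ
  calc lyapunov ϑ p u ≤ (1 + ρ * ‖θ - ϑ‖ ^ 2 + c) ^ (p / 2) :=
        Real.rpow_le_rpow (by positivity) (by linarith) hq
    _ ≤ (1 + ρ * ‖θ - ϑ‖ ^ 2) ^ (p / 2) + c ^ (p / 2) :=
        Real.rpow_add_le_add_rpow (by positivity) hc hq hq1
    _ ≤ 1 ^ (p / 2) + (ρ * ‖θ - ϑ‖ ^ 2) ^ (p / 2) + c ^ (p / 2) := by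
        gcongr
        exact Real.rpow_add_le_add_rpow zero_le_one (by positivity) hq hq1
    _ = 1 + ρ ^ (p / 2) * (‖θ - ϑ‖ ^ 2) ^ (p / 2) + c ^ (p / 2) := by
        rw [Real.one_rpow, Real.mul_rpow hρ (by positivity)]
    _ ≤ lyapunov ϑ p θ + ρ ^ (p / 2) * lyapunov ϑ p θ + c ^ (p / 2) * lyapunov ϑ p θ := by
        gcongr
        · exact Real.rpow_le_rpow (by positivity) (by linarith) hq
        · exact le_mul_of_one_le_right (by positivity) hone
    _ = (1 + ρ ^ (p / 2) + c ^ (p / 2)) * lyapunov ϑ p θ := by ring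

theorem lyapunov_le_mul_lyapunov_of_mem_segment (hp : 0 ≤ p) (hp2 : p ≤ 2) {ρ c : ℝ} (hρ : 0 ≤ ρ)
    (hc : 0 ≤ c) {a b u θ : EuclideanSpace ℝ (Fin d)} (hu : u ∈ segment ℝ a b)
    (ha : ‖a - ϑ‖ ^ 2 ≤ ρ * ‖θ - ϑ‖ ^ 2 + c) (hb : ‖b - ϑ‖ ^ 2 ≤ ρ * ‖θ - ϑ‖ ^ 2 + c) :
    lyapunov ϑ p u ≤ (1 + ρ ^ (p / 2) + c ^ (p / 2)) * lyapunov ϑ p θ := by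
  have hball : ∀ w : EuclideanSpace ℝ (Fin d), w ∈ Metric.closedBall ϑ √(ρ * ‖θ - ϑ‖ ^ 2 + c) ↔
      ‖w - ϑ‖ ^ 2 ≤ ρ * ‖θ - ϑ‖ ^ 2 + c := fun w => by
    rw [mem_closedBall_iff_norm, Real.le_sqrt (norm_nonneg _) (by positivity)]
  exact lyapunov_le_mul_lyapunov hp hp2 hρ hc ((hball u).1
    ((convex_closedBall ϑ _).segment_subset ((hball a).2 ha) ((hball b).2 hb) hu))

theorem norm_add_half_le_mul_lyapunov_one (θ : EuclideanSpace ℝ (Fin d)) :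
    ‖θ‖ + 1 / 2 ≤ (2 + ‖ϑ‖) * lyapunov ϑ 1 θ := by
  have htriangle : ‖θ‖ ≤ ‖θ - ϑ‖ + ‖ϑ‖ := norm_le_norm_sub_add θ ϑ
  have hone := one_le_lyapunov (ϑ := ϑ) zero_le_one θ
  have hnorm : ‖θ - ϑ‖ ≤ lyapunov ϑ 1 θ := by
    rw [lyapunov_eq_sqrt_rpow, Real.rpow_one]
    exact Real.le_sqrt_of_sq_le (by linarith)
  nlinarith [norm_nonneg ϑ]

end Lyapunov

/-! ### The drift of gradient descent -/

section DissipativeField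

variable {E : Type*} [NormedAddCommGroup E] [InnerProductSpace ℝ E] {m K L η : ℝ}

theorem norm_sub_smul_sq_le_of_dissipative (hη : 0 ≤ η) {y G : E}
    (hinner : m * ‖y‖ ^ 2 - K ≤ inner ℝ G y) (hG : ‖G‖ ≤ L * ‖y‖) :
    ‖y - η • G‖ ^ 2 ≤ (1 - 2 * η * m + η ^ 2 * L ^ 2) * ‖y‖ ^ 2 + 2 * η * K := by
  calc ‖y - η • G‖ ^ 2 = ‖y‖ ^ 2 - 2 * η * inner ℝ G y + η ^ 2 * ‖G‖ ^ 2 := by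
        rw [norm_sub_sq_real, real_inner_smul_right, norm_smul, mul_pow, Real.norm_eq_abs, sq_abs,
          real_inner_comm]
        ring
    _ ≤ ‖y‖ ^ 2 - 2 * η * (m * ‖y‖ ^ 2 - K) + η ^ 2 * (L * ‖y‖) ^ 2 := by gcongr
    _ = (1 - 2 * η * m + η ^ 2 * L ^ 2) * ‖y‖ ^ 2 + 2 * η * K := by ring

theorem le_of_dissipative_of_norm_le [Nontrivial E] {G : E → E}
    (hinner : ∀ y, m * ‖y‖ ^ 2 - K ≤ inner ℝ (G y) y) (hG : ∀ y, ‖G y‖ ≤ L * ‖y‖) : m ≤ L := by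
  by_contra! hLm
  have hquadratic : ∀ r : ℝ, 0 ≤ r → (m - L) * r ^ 2 ≤ K := fun r hr => by
    obtain ⟨y, rfl⟩ := exists_norm_eq E hr
    nlinarith [hinner y, hG y, real_inner_le_norm (G y) y, norm_nonneg y]
  have hpos : 0 < m - L := sub_pos.2 hLm
  have hK : 0 ≤ K := by simpa using hquadratic 0 le_rfl
  have hcontra := hquadratic √((K + 1) / (m - L)) (Real.sqrt_nonneg _)
  rw [Real.sq_sqrt (by positivity), mul_div_cancel₀ _ hpos.ne'] at hcontra
  linarith

theorem contractionFactor_nonneg (hη : 0 ≤ η) (hmL : m ≤ L) :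
    0 ≤ 1 - 2 * η * m + η ^ 2 * L ^ 2 := by
  nlinarith [sq_nonneg (1 - η * L), mul_le_mul_of_nonneg_left hmL hη]

end DissipativeField

section GradientStep

variable {d n : ℕ} {S : Type*} {f : EuclideanSpace ℝ (Fin d) → S → ℝ} {X X' : Fin n → S}
  {θ ϑ : EuclideanSpace ℝ (Fin d)}

/-- The deterministic part `θ - η ∇F(θ, X)` of a step of noisy gradient descent, that is, the centre
of the law `P(θ, ·)`. -/
def gradientStep (f : EuclideanSpace ℝ (Fin d) → S → ℝ) (η : ℝ) (X : Fin n → S)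
    (θ : EuclideanSpace ℝ (Fin d)) : EuclideanSpace ℝ (Fin d) :=
  θ - η • gradient (empiricalRisk f X) θ

theorem gradient_empiricalRisk (hf : ∀ i, DifferentiableAt ℝ (fun w => f w (X i)) θ) :
    gradient (empiricalRisk f X) θ = (1 / (n : ℝ)) • ∑ i, gradient (fun w => f w (X i)) θ := by
  have hfderiv : fderiv ℝ (empiricalRisk f X) θ
      = (1 / (n : ℝ)) • ∑ i, fderiv ℝ (fun w => f w (X i)) θ := by
    unfold empiricalRisk
    rw [fderiv_const_mul (.fun_sum fun i _ => hf i), fderiv_fun_sum fun i _ => hf i]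
  simp only [gradient, hfderiv, map_smul, map_sum]

theorem gradient_empiricalRisk_mem_of_convex (hn : 0 < n)
    (hf : ∀ i, DifferentiableAt ℝ (fun w => f w (X i)) θ) {s : Set (EuclideanSpace ℝ (Fin d))}
    (hs : Convex ℝ s) (hmem : ∀ i, gradient (fun w => f w (X i)) θ ∈ s) :
    gradient (empiricalRisk f X) θ ∈ s := by
  rw [gradient_empiricalRisk hf, Finset.smul_sum]
  refine hs.sum_mem (fun i _ => by positivity) ?_ fun i _ => hmem i
  simp [hn.ne']

theorem norm_gradientStep_sub_sq_le (hn : 0 < n)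
    (hf : ∀ i, DifferentiableAt ℝ (fun w => f w (X i)) θ) {m K L η : ℝ} (hη : 0 ≤ η)
    (hinner : ∀ i, m * ‖θ - ϑ‖ ^ 2 - K ≤ inner ℝ (gradient (fun w => f w (X i)) θ) (θ - ϑ))
    (hnorm : ∀ i, ‖gradient (fun w => f w (X i)) θ‖ ≤ L * ‖θ - ϑ‖) :
    ‖gradientStep f η X θ - ϑ‖ ^ 2
      ≤ (1 - 2 * η * m + η ^ 2 * L ^ 2) * ‖θ - ϑ‖ ^ 2 + 2 * η * K := by
  rw [gradientStep, sub_right_comm]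
  refine norm_sub_smul_sq_le_of_dissipative hη ?_ ?_
  · simp_rw [real_inner_comm (θ - ϑ)] at hinner ⊢
    exact gradient_empiricalRisk_mem_of_convex hn hf
      (convex_halfSpace_ge (innerSL ℝ (θ - ϑ)).isLinear _) hinner
  · rw [← mem_closedBall_zero_iff]
    exact gradient_empiricalRisk_mem_of_convex hn hf (convex_closedBall 0 _)
      fun i => mem_closedBall_zero_iff.2 (hnorm i)

theorem norm_gradientStep_sub_gradientStep_le (hf : ∀ i, DifferentiableAt ℝ (fun w => f w (X i)) θ)
    (hf' : ∀ i, DifferentiableAt ℝ (fun w => f w (X' i)) θ) (hXX' : Neighboring X X') {η C : ℝ}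
    (hη : 0 ≤ η) (hC : ∀ i,
      ‖gradient (fun w => f w (X i)) θ - gradient (fun w => f w (X' i)) θ‖ ≤ C) :
    ‖gradientStep f η X θ - gradientStep f η X' θ‖ ≤ η * (1 / (n : ℝ) * C) := by
  obtain ⟨i, hi⟩ := hXX'
  rw [gradientStep, gradientStep, sub_sub_sub_cancel_left, norm_sub_rev, ← smul_sub, norm_smul,
    Real.norm_of_nonneg hη, gradient_empiricalRisk hf, gradient_empiricalRisk hf', ← smul_sub,
    ← Finset.sum_sub_distrib, Finset.sum_eq_single i (fun j _ hj => by rw [hi j hj, sub_self])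
    (by simp), norm_smul, Real.norm_of_nonneg (by positivity)]
  gcongr
  exact hC i

end GradientStep

/-! ### Comparison of the transition kernels -/

section Kernel

variable {d n : ℕ} {S : Type*} {f : EuclideanSpace ℝ (Fin d) → S → ℝ} {X X' : Fin n → S}
  {α p η σ : ℝ} {θ ϑ : EuclideanSpace ℝ (Fin d)} {ν : Measure (EuclideanSpace ℝ (Fin d))}

theorem gdKernel_apply [SFinite ν] (θ : EuclideanSpace ℝ (Fin d)) :
    gdKernel f η σ ν X θ = ν.map (fun z => gradientStep f η X θ + σ • z) := rfl

variable [NeZero d] [IsFiniteMeasure ν]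

theorem integrable_lyapunov_gdKernel (hν : IsRotInvStable α ν) (hα : α ≤ 2) (hp : 0 ≤ p)
    (hp1 : p ≤ 1) (hpα : p < α) (hσ : 0 ≤ σ) (θ : EuclideanSpace ℝ (Fin d)) :
    Integrable (lyapunov ϑ p) (gdKernel f η σ ν X θ) := by
  rw [gdKernel_apply, integrable_map_measure measurable_lyapunov.aestronglyMeasurable
    (by fun_prop)]
  exact integrable_comp_add_smul_of_abs_le hσ (lyapunov_add_le hp hp1) measurable_lyapunov
    (fun y => (abs_of_pos (lyapunov_pos y)).le) (hν.integrable_norm_rpow hα hp hpα) _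

theorem vNorm_gdKernel_le (hν : IsRotInvStable α ν) (hα : α ≤ 2) (hp : 0 ≤ p) (hp1 : p ≤ 1)
    (hpα : p < α) (hσ : 0 < σ) {A : ℝ} (hA : ∀ u ∈ segment ℝ (gradientStep f η X' θ)
      (gradientStep f η X θ), lyapunov ϑ p u ≤ A) :
    vNorm (lyapunov ϑ p) (gdKernel f η σ ν X θ) (gdKernel f η σ ν X' θ)
      ≤ ENNReal.ofReal (‖gradientStep f η X θ - gradientStep f η X' θ‖ / σ *
          stableShiftWeight d α p σ A) := by
  refine iSup_le fun g => iSup_le fun hg => iSup_le fun hgV => ENNReal.ofReal_le_ofReal ?_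
  rw [gdKernel_apply, gdKernel_apply, integral_map (by fun_prop) hg.aestronglyMeasurable,
    integral_map (by fun_prop) hg.aestronglyMeasurable]
  exact hν.norm_integral_shift_le hα hp hp1 hpα hσ measurable_lyapunov (lyapunov_add_le hp hp1)
    hg hgV hA

end Kernel

namespace PseudoLipschitzGradient

variable {d n : ℕ} {S : Type*} [NormedAddCommGroup S] {f : EuclideanSpace ℝ (Fin d) → S → ℝ}
  {𝒳 : Set S} {K₁ K₂ m K η D : ℝ} {θ ϑ : EuclideanSpace ℝ (Fin d)}

theorem norm_gradient_le (hLip : PseudoLipschitzGradient f 𝒳 K₁ K₂)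
    (hϑ : IsUniversalStablePoint f 𝒳 ϑ) {x : S} (hx : x ∈ 𝒳) :
    ‖gradient (fun w => f w x) θ‖ ≤ K₁ * ‖θ - ϑ‖ := by
  simpa [hϑ x hx] using hLip.bound θ ϑ x hx x hx

theorem norm_gradientStep_sub_gradientStep_le (hLip : PseudoLipschitzGradient f 𝒳 K₁ K₂)
    (hD : ∀ x ∈ 𝒳, ∀ x' ∈ 𝒳, ‖x - x'‖ ≤ D) (hη : 0 ≤ η) {X X' : Fin n → S}
    (hX : ∀ i, X i ∈ 𝒳) (hX' : ∀ i, X' i ∈ 𝒳) (hXX' : Neighboring X X') :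
    ‖gradientStep f η X θ - gradientStep f η X' θ‖
      ≤ η * (1 / n * (K₂ * D * (‖θ‖ + ‖θ‖ + 1))) := by
  refine HeavyTailedGD.norm_gradientStep_sub_gradientStep_le
    (fun i => hLip.differentiable _ (hX i) θ) (fun i => hLip.differentiable _ (hX' i) θ) hXX' hη
    fun i => (hLip.bound θ θ _ (hX i) _ (hX' i)).trans ?_
  have := hLip.K₂_pos
  rw [sub_self, norm_zero, mul_zero, zero_add]
  gcongr
  exact hD _ (hX i) _ (hX' i)

theorem le_of_dissipative [NeZero d] (hLip : PseudoLipschitzGradient f 𝒳 K₁ K₂)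
    (hϑ : IsUniversalStablePoint f 𝒳 ϑ) {x : S} (hx : x ∈ 𝒳)
    (hinner : ∀ θ, m * ‖θ - ϑ‖ ^ 2 - K ≤ inner ℝ (gradient (fun w => f w x) θ) (θ - ϑ)) :
    m ≤ K₁ :=
  le_of_dissipative_of_norm_le (G := fun y => gradient (fun w => f w x) (ϑ + y))
    (fun y => by simpa only [add_sub_cancel_left] using hinner (ϑ + y))
    fun y => by simpa only [add_sub_cancel_left] using hLip.norm_gradient_le hϑ hx (θ := ϑ + y)

end PseudoLipschitzGradient

section Constant

variable {d : ℕ} {α p η σ m K K₁ K₂ D : ℝ}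

theorem cGamma_eq (ϑ : EuclideanSpace ℝ (Fin d)) :
    cGamma d α p η σ m K K₁ K₂ D ϑ = 2 * (2 * K₂ * D * η / σ) *
      stableShiftWeight d α p σ
        (√2 + (1 - 2 * η * m + η ^ 2 * K₁ ^ 2) ^ (p / 2) + (2 * η * K) ^ (p / 2)) *
      (2 + ‖ϑ‖) := by
  have hmoment : gaussianNormMoment d (2 * p)
      = 2 ^ p * (Real.Gamma (p + d / 2) / Real.Gamma (d / 2)) := by
    rw [gaussianNormMoment, mul_div_cancel_left₀ p two_ne_zero, add_div,
      mul_div_cancel_left₀ p two_ne_zero]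
  simp only [cGamma, stableShiftWeight, hmoment]
  ring

theorem cGamma_pos (hα : 0 < α) (hp : p ≤ 1) (hη : 0 < η) (hσ : 0 < σ) (hK₂ : 0 < K₂) (hD : 0 < D)
    (hK : 0 ≤ K) (hρ : 0 ≤ 1 - 2 * η * m + η ^ 2 * K₁ ^ 2) (ϑ : EuclideanSpace ℝ (Fin d)) :
    0 < cGamma d α p η σ m K K₁ K₂ D ϑ := by
  have := stableShiftWeight_pos (d := d) (A := √2 +
    (1 - 2 * η * m + η ^ 2 * K₁ ^ 2) ^ (p / 2) + (2 * η * K) ^ (p / 2)) hα hp hσ (by positivity)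
  rw [cGamma_eq]
  positivity

theorem div_mul_stableShiftWeight_le_cGamma (hα : 0 < α) (hp : 0 ≤ p) (hp1 : p ≤ 1)
    (hη : 0 ≤ η) (hσ : 0 < σ) (hK₂ : 0 ≤ K₂) (hD : 0 ≤ D) (hK : 0 ≤ K)
    (hρ : 0 ≤ 1 - 2 * η * m + η ^ 2 * K₁ ^ 2) {n : ℕ} {δ : ℝ} {θ ϑ : EuclideanSpace ℝ (Fin d)}
    (hδ : δ ≤ η * (1 / n * (K₂ * D * (‖θ‖ + ‖θ‖ + 1)))) :
    δ / σ * stableShiftWeight d α p σ ((1 + (1 - 2 * η * m + η ^ 2 * K₁ ^ 2) ^ (p / 2) +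
        (2 * η * K) ^ (p / 2)) * lyapunov ϑ p θ)
      ≤ cGamma d α p η σ m K K₁ K₂ D ϑ / n * lyapunov ϑ (1 + p) θ := by
  set ρ := 1 - 2 * η * m + η ^ 2 * K₁ ^ 2
  set w := stableShiftWeight d α p σ (√2 + ρ ^ (p / 2) + (2 * η * K) ^ (p / 2))
  have hw_pos : 0 < w := stableShiftWeight_pos hα hp1 hσ (by positivity)
  have hV : 0 < lyapunov ϑ p θ := lyapunov_pos θ
  have hV₁ : 0 < lyapunov ϑ 1 θ := lyapunov_pos θ
  have hweight : stableShiftWeight d α p σ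
      ((1 + ρ ^ (p / 2) + (2 * η * K) ^ (p / 2)) * lyapunov ϑ p θ) ≤ w * lyapunov ϑ p θ := by
    refine (stableShiftWeight_mul_le hα hp1 hσ (one_le_lyapunov hp θ)).trans ?_
    gcongr
    exact stableShiftWeight_mono hα (by gcongr; exact Real.one_le_sqrt.2 one_le_two)
  have hshift : δ ≤ 2 * K₂ * D * η / n * ((2 + ‖ϑ‖) * lyapunov ϑ 1 θ) :=
    calc δ ≤ 2 * K₂ * D * η / n * (‖θ‖ + 1 / 2) := hδ.trans_eq (by ring)
      _ ≤ _ := by gcongr; exact norm_add_half_le_mul_lyapunov_one θ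
  calc _ ≤ 2 * K₂ * D * η / n * ((2 + ‖ϑ‖) * lyapunov ϑ 1 θ) / σ * (w * lyapunov ϑ p θ) :=
        mul_le_mul (by gcongr) hweight (stableShiftWeight_pos hα hp1 hσ (by positivity)).le
          (by positivity)
    _ ≤ 2 * (2 * K₂ * D * η / n * ((2 + ‖ϑ‖) * lyapunov ϑ 1 θ) / σ * (w * lyapunov ϑ p θ)) :=
        le_mul_of_one_le_left (by positivity) one_le_two
    _ = cGamma d α p η σ m K K₁ K₂ D ϑ / n * lyapunov ϑ (1 + p) θ := by
        rw [cGamma_eq, ← lyapunov_one_mul]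
        ring

end Constant

end

end HeavyTailedGD

open HeavyTailedGD in
theorem mainTheorem6_general {d n : ℕ} [NeZero d] {S : Type*} [NormedAddCommGroup S] (𝒳 : Set S)
    (f : EuclideanSpace ℝ (Fin d) → S → ℝ) (α p η σ : ℝ) (hα : α ≤ 2) (hp : 0 ≤ p) (hp1 : p ≤ 1)
    (hpα : p < α) (hη : 0 < η) (hσ : 0 < σ) (ν : Measure (EuclideanSpace ℝ (Fin d)))
    [IsFiniteMeasure ν] (hν : IsRotInvStable α ν) (K₁ K₂ m K D : ℝ)
    (hLip : PseudoLipschitzGradient f 𝒳 K₁ K₂) (hD : ∀ x ∈ 𝒳, ∀ x' ∈ 𝒳, ‖x - x'‖ ≤ D)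
    (ϑ : EuclideanSpace ℝ (Fin d)) (hϑ : IsUniversalStablePoint f 𝒳 ϑ)
    (hDiss : ∀ θ, ∀ x ∈ 𝒳,
      m * ‖θ - ϑ‖ ^ 2 - K ≤ inner ℝ (gradient (fun w => f w x) θ) (θ - ϑ))
    (X X' : Fin n → S) (hX : ∀ i, X i ∈ 𝒳) (hX' : ∀ i, X' i ∈ 𝒳) (hXX' : Neighboring X X') :
    (0 < D → 0 < cGamma d α p η σ m K K₁ K₂ D ϑ) ∧
    (∀ θ, Integrable (lyapunov ϑ p) (gdKernel f η σ ν X θ) ∧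
      Integrable (lyapunov ϑ p) (gdKernel f η σ ν X' θ)) ∧
    (⨆ θ, vNorm (lyapunov ϑ p) (gdKernel f η σ ν X θ) (gdKernel f η σ ν X' θ)
        / ENNReal.ofReal (lyapunov ϑ (1 + p) θ))
      ≤ ENNReal.ofReal (cGamma d α p η σ m K K₁ K₂ D ϑ / n) := by
  have hn : 0 < n := Fin.pos hXX'.choose
  have hx : X ⟨0, hn⟩ ∈ 𝒳 := hX _
  have hD0 : 0 ≤ D := (norm_nonneg _).trans (hD _ hx _ hx)
  have hK : 0 ≤ K := by simpa using hDiss ϑ _ hx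
  have hρ : 0 ≤ 1 - 2 * η * m + η ^ 2 * K₁ ^ 2 :=
    contractionFactor_nonneg hη.le (hLip.le_of_dissipative hϑ hx fun θ => hDiss θ _ hx)
  have hdrift : ∀ Y : Fin n → S, (∀ i, Y i ∈ 𝒳) → ∀ θ, ‖gradientStep f η Y θ - ϑ‖ ^ 2
      ≤ (1 - 2 * η * m + η ^ 2 * K₁ ^ 2) * ‖θ - ϑ‖ ^ 2 + 2 * η * K := fun Y hY θ =>
    norm_gradientStep_sub_sq_le hn (fun i => hLip.differentiable _ (hY i) θ) hη.le
      (fun i => hDiss θ _ (hY i)) fun i => hLip.norm_gradient_le hϑ (hY i)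
  have hint : ∀ (Y : Fin n → S) θ, Integrable (lyapunov ϑ p) (gdKernel f η σ ν Y θ) := fun Y =>
    integrable_lyapunov_gdKernel hν hα hp hp1 hpα hσ.le
  refine ⟨fun hD_pos => cGamma_pos (hp.trans_lt hpα) hp1 hη hσ hLip.K₂_pos hD_pos hK hρ ϑ,
    fun θ => ⟨hint X θ, hint X' θ⟩, iSup_le fun θ => ENNReal.div_le_of_le_mul ?_⟩
  rw [← ENNReal.ofReal_mul' (lyapunov_pos θ).le]
  refine (vNorm_gdKernel_le hν hα hp hp1 hpα hσ fun u hu =>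
    lyapunov_le_mul_lyapunov_of_mem_segment hp (by linarith) hρ (by positivity) hu
      (hdrift X' hX' θ) (hdrift X hX θ)).trans (ENNReal.ofReal_le_ofReal ?_)
  exact div_mul_stableShiftWeight_le_cGamma (hp.trans_lt hpα) hp hp1 hη.le hσ hLip.K₂_pos.le hD0 hK
    hρ (hLip.norm_gradientStep_sub_gradientStep_le hD hη.le hX hX' hXX')

theorem mainTheorem6 {d n : ℕ} (hd : 0 < d)
    {S : Type*} [NormedAddCommGroup S] [NormedSpace ℝ S] (𝒳 : Set S)
    (f : EuclideanSpace ℝ (Fin d) → S → ℝ)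
    (α p η σ : ℝ) (hα : 1 < α) (hα' : α < 2) (hp : 0 < p) (hp' : p < min (1 / 2) (α - 1))
    (hη : 0 < η) (hσ : 0 < σ)
    (ν : Measure (EuclideanSpace ℝ (Fin d))) [IsProbabilityMeasure ν]
    (hν : HeavyTailedGD.IsRotInvStable α ν)
    (K₁ K₂ B m K D : ℝ)
    (hLip : HeavyTailedGD.PseudoLipschitzGradient f 𝒳 K₁ K₂)
    (hDiss : HeavyTailedGD.UniformlyDissipative f 𝒳 B m K)
    (hD : ∀ x ∈ 𝒳, ∀ x' ∈ 𝒳, ‖x - x'‖ ≤ D)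
    (ϑ : EuclideanSpace ℝ (Fin d)) (hϑ : HeavyTailedGD.IsUniversalStablePoint f 𝒳 ϑ)
    (X X' : Fin n → S) (hX : ∀ i, X i ∈ 𝒳) (hX' : ∀ i, X' i ∈ 𝒳)
    (hXX' : HeavyTailedGD.Neighboring X X') :
    (0 < D → 0 < HeavyTailedGD.cGamma d α p η σ m K K₁ K₂ D ϑ) ∧
    (∀ θ, Integrable (HeavyTailedGD.lyapunov ϑ p) (HeavyTailedGD.gdKernel f η σ ν X θ) ∧
      Integrable (HeavyTailedGD.lyapunov ϑ p) (HeavyTailedGD.gdKernel f η σ ν X' θ)) ∧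
    (⨆ θ, HeavyTailedGD.vNorm (HeavyTailedGD.lyapunov ϑ p)
          (HeavyTailedGD.gdKernel f η σ ν X θ) (HeavyTailedGD.gdKernel f η σ ν X' θ)
        / ENNReal.ofReal (HeavyTailedGD.lyapunov ϑ (1 + p) θ))
      ≤ ENNReal.ofReal (HeavyTailedGD.cGamma d α p η σ m K K₁ K₂ D ϑ / n) := by
  have : NeZero d := .of_pos hd
  exact mainTheorem6_general 𝒳 f α p η σ hα'.le hp.le (by linarith [hp'.trans_le (min_le_left _ _)])
    (by linarith [hp'.trans_le (min_le_right _ _)]) hη hσ ν hν K₁ K₂ m K D hLip hD ϑ hϑ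
    (fun θ x hx => by simpa only [hϑ x hx, sub_zero] using hDiss.dissipative θ ϑ x hx)
    X X' hX hX' hXX'
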